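/- Throughout, $n\ge 2$, $B(x,r)$ is the open ball of radius $r$ centred at $x$ in $\mathbb R^n$, and $\mathcal H^{n-1}$ is the Hausdorff measure normalized so that the unit ball of $\mathbb R^{n-1}$ has its Lebesgue measure. For an open set $\Omega\subset\mathbb R^n$, $Q\in\partial\Omega$ and $r>0$ put $\Delta(Q,r)=\partial\Omega\cap B(Q,r)$. **Corkscrew domains.** A *non-tangential point* of an open set $U$ at $Q$ and scale $r$, with constant $M$, is a point $A\in U$ with $|A-Q|<r$ and $\operatorname{dist}(A,\partial U)>r/M$. An open connected non-empty set $\Omega\subset\mathbb R^n$ is a *corkscrew domain* with constants $M>1$, $R>0$ if for all $Q\in\partial\Omega$ and $0<r<R$ there exist a non-tangential point $A^+(Q,r)$ of $\Omega$ and a non-tangential point $A^-(Q,r)$ of $\mathbb R^n\setminus\overline\Omega$ at $Q$ and scale $r$, both with constant $M$. **Lipschitz domains.** A bounded, non-empty, open, connected set $D\subset\mathbb R^n$ is a *Lipschitz domain* with Lipschitz constant at most $L$ and character $(N,\rho)$, $\rho>0$, if $\partial D$ is covered by $N$ balls $B(p_i,\rho)$ with $p_i\in\partial D$ (repetitions allowed),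 such that for every $i$ there are Cartesian coordinates $(x,t)\in\mathbb R^{n-1}\times\mathbb R$ of $\mathbb R^n$ (a rigid motion) and an $L$-Lipschitz function $\varphi_i:\mathbb R^{n-1}\to\mathbb R$ with $D\cap B(p_i,2\rho)=\{t>\varphi_i(x)\}\cap B(p_i,2\rho)$. **Theorem 2.4.** Let $n\ge2$ and $M>1$. There is a constant $\psi=\psi(n,M)>0$, and for every $\gamma\in\mathbb R$ there are constants $L\ge0$, $N\in\mathbb N$, $c>0$ depending only on $n$, $M$, $\gamma$, with the following property. Let $\Omega\subset\mathbb R^n$ be a corkscrew domain with constants $M$ and $R>0$, let $Q\in\partial\Omega$ and $0<r<R$ satisfy $$\mathcal H^{n-1}(\Delta(Q,r))\le\gamma\, r^{n-1}$$ (so, whenever $\mathcal H^{n-1}(\Delta(Q,r))<\infty$, one may take $\gamma=\mathcal H^{n-1}(\Delta(Q,r))/r^{n-1}$), and let $a$ be any non-tangential point of $\Omega$ at $Q$ and scale $r/2$ with constant $M$. Then there is a Lipschitz domain $\Omega_L$ with Lipschitz constant at most $L$ and character $(N,cr)$ such that 1. $a\in\Omega_L\subset\Omega\cap B(Q,r)$;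 2. $\mathcal H^{n-1}(\partial\Omega_L\cap\partial\Omega)\ge\psi\, r^{n-1}$; 3. $\partial\Omega_L\cap\partial\Omega$ is contained in a single graph $\{t=\varphi(x)\}$ of an $L$-Lipschitz function $\varphi:\mathbb R^{n-1}\to\mathbb R$, in suitable Cartesian coordinates. No upper Ahlfors regularity of $\partial\Omega$ is assumed. -/

import Mathlib

open MeasureTheory Set Metric
open scoped NNReal ENNReal

/-- `A` is a non-tangential point of the open set `U` at the point `Q` and scale `r`, with
constant `M`: `A ∈ U`, `|A - Q| < r` and `dist (A, ∂U) > r / M`. -/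
def IsNontangentialPoint {n : ℕ} (U : Set (EuclideanSpace ℝ (Fin n))) (M : ℝ)
    (Q : EuclideanSpace ℝ (Fin n)) (r : ℝ) (A : EuclideanSpace ℝ (Fin n)) : Prop :=
  A ∈ U ∧ dist A Q < r ∧ r / M < infDist A (frontier U)

/-- `Ω` is a corkscrew domain with constants `M` and `R`: it is open and connected, and at every
boundary point `Q ∈ ∂Ω` and every scale `0 < r < R` there are non-tangential points (with
constant `M`) both of the interior `Ω` and of the exterior, the complement of the closure
of `Ω`. -/
structure IsCorkscrewDomain {n : ℕ} (Ω : Set (EuclideanSpace ℝ (Fin n))) (M R : ℝ) : Prop where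
  isOpen : IsOpen Ω
  isConnected : IsConnected Ω
  interior_corkscrew : ∀ Q ∈ frontier Ω, ∀ r : ℝ, 0 < r → r < R →
    ∃ A, IsNontangentialPoint Ω M Q r A
  exterior_corkscrew : ∀ Q ∈ frontier Ω, ∀ r : ℝ, 0 < r → r < R →
    ∃ A, IsNontangentialPoint (closure Ω)ᶜ M Q r A

/-- Cartesian coordinate systems `(x, t)` on `ℝⁿ`, with `x ∈ ℝⁿ⁻¹` and `t ∈ ℝ`; they differ from
each other by rigid motions. -/
abbrev CartesianChart (n : ℕ) : Type :=
  EuclideanSpace ℝ (Fin n) ≃ᵃⁱ[ℝ] WithLp 2 (EuclideanSpace ℝ (Fin (n - 1)) × ℝ)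

/-- The graph `t = φ x` in the coordinates `e`. -/
def graphSet {n : ℕ} (e : CartesianChart n) (φ : EuclideanSpace ℝ (Fin (n - 1)) → ℝ) :
    Set (EuclideanSpace ℝ (Fin n)) :=
  {y | (e y).snd = φ (e y).fst}

/-- The open region `t > φ x` above the graph of `φ` in the coordinates `e`. -/
def aboveGraph {n : ℕ} (e : CartesianChart n) (φ : EuclideanSpace ℝ (Fin (n - 1)) → ℝ) :
    Set (EuclideanSpace ℝ (Fin n)) :=
  {y | φ (e y).fst < (e y).snd}

/-- `D` is a (bounded) Lipschitz domain with Lipschitz constant at most `L` and Lipschitz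
character controlled by `N` and `ρ`: `∂D` is covered by `N` balls of radius `ρ` centred on `∂D`
such that in each of the concentric balls of radius `2ρ` the domain `D` is, in suitable Cartesian
coordinates, the region above the graph of an `L`-Lipschitz function. -/
structure IsLipschitzDomain {n : ℕ} (D : Set (EuclideanSpace ℝ (Fin n))) (L : ℝ≥0) (N : ℕ)
    (ρ : ℝ) : Prop where
  isOpen : IsOpen D
  isConnected : IsConnected D
  isBounded : Bornology.IsBounded D
  radius_pos : 0 < ρ
  exists_charts : ∃ p : Fin N → EuclideanSpace ℝ (Fin n),
    (∀ i, p i ∈ frontier D) ∧ frontier D ⊆ ⋃ i, ball (p i) ρ ∧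
    ∀ i, ∃ (e : CartesianChart n) (φ : EuclideanSpace ℝ (Fin (n - 1)) → ℝ),
      LipschitzWith L φ ∧ D ∩ ball (p i) (2 * ρ) = aboveGraph e φ ∩ ball (p i) (2 * ρ)

/-! Use the line from `a` to an exterior corkscrew point at scale `r / 2` as vertical axis. Over a
disc of radius `w = r / (2 * M)` vertical segments start in `Ω` and end outside it, so each has a
first exit height `h x`; for `‖x‖ < w / 2` it exits at a point of `∂Ω`. Let `φ` be the greatest
`L`-Lipschitz function below `h` on that smaller disc. The domain is the region below `φ` and above
a floor, over a small cube. It lies in `Ω`, and its boundary meets `∂Ω` wherever `φ = h`. As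
projection to the base does not increase Hausdorff measure, it is enough that the set `φ < h` fills
at most half of a fixed ball. Half the volume of that ball is `ψ r ^ (n - 1)`, which explains why
`ψ` does not depend on `γ`.

The estimate is `mul_volume_noncontact_le`. If `φ x < h x`, then `h` drops from `x` to some `y` by
more than `L * dist x y`. For large `L` this drop is visible at `N` consecutive scales `s` of a
geometric sequence. Suppose that the column over the ball of radius `4 * s` about `x` never carries
too much boundary. A pigeonhole argument (`exists_level`) then gives horizontal discs inside `Ω`
above and below the exit point over `y`, while an exterior corkscrew ball sits between them.
Vertical lines through that ball must re-enter `Ω`, and the re-entry points form a piece of `∂Ω` of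
measure comparable to `s ^ (n - 1)` (`volume_ball_le_measure_upcrossing`). Pieces from different
scales are disjoint. By Vitali covering and summation over the scales, `N` times the measure of such
`x` is at most a constant depending on `n` and `M` times the boundary measure; columns with too much
boundary obey the same bound. A large `N` then absorbs `γ`. -/

/-! ### Cartesian charts, vertical projection, and cones versus Lipschitz graphs -/

section Charts

variable {n : ℕ}

/-- The point with coordinates `(x, t)` in the chart `e`. -/
noncomputable def chartPoint (e : CartesianChart n) (x : EuclideanSpace ℝ (Fin (n - 1))) (t : ℝ) :
    EuclideanSpace ℝ (Fin n) :=
  e.symm (WithLp.toLp 2 (x, t))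

@[simp]
theorem chart_chartPoint_fst (e : CartesianChart n) (x : EuclideanSpace ℝ (Fin (n - 1))) (t : ℝ) :
    (e (chartPoint e x t)).fst = x := by
  simp [chartPoint]

@[simp]
theorem chart_chartPoint_snd (e : CartesianChart n) (x : EuclideanSpace ℝ (Fin (n - 1))) (t : ℝ) :
    (e (chartPoint e x t)).snd = t := by
  simp [chartPoint]

@[simp]
theorem chartPoint_chart (e : CartesianChart n) (p : EuclideanSpace ℝ (Fin n)) :
    chartPoint e (e p).fst (e p).snd = p :=
  e.symm_apply_apply p

theorem continuous_chartPoint (e : CartesianChart n) :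
    Continuous fun q : EuclideanSpace ℝ (Fin (n - 1)) × ℝ => chartPoint e q.1 q.2 :=
  e.symm.continuous.comp (WithLp.prod_continuous_toLp 2 _ _)

theorem dist_sq_chart (e : CartesianChart n) (p q : EuclideanSpace ℝ (Fin n)) :
    dist p q ^ 2 = dist (e p).fst (e q).fst ^ 2 + dist (e p).snd (e q).snd ^ 2 := by
  rw [← e.dist_map p q, WithLp.prod_dist_eq_of_L2, Real.sq_sqrt (by positivity)]

theorem dist_chart_fst_le (e : CartesianChart n) (p q : EuclideanSpace ℝ (Fin n)) :
    dist (e p).fst (e q).fst ≤ dist p q :=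
  abs_le_of_sq_le_sq' (by nlinarith [dist_sq_chart e p q]) dist_nonneg |>.2

theorem dist_chart_snd_le (e : CartesianChart n) (p q : EuclideanSpace ℝ (Fin n)) :
    dist (e p).snd (e q).snd ≤ dist p q :=
  abs_le_of_sq_le_sq' (by nlinarith [dist_sq_chart e p q]) dist_nonneg |>.2

theorem dist_le_chart (e : CartesianChart n) (p q : EuclideanSpace ℝ (Fin n)) :
    dist p q ≤ dist (e p).fst (e q).fst + dist (e p).snd (e q).snd := by
  have h1 : 0 ≤ dist (e p).fst (e q).fst := dist_nonneg
  have h2 : 0 ≤ dist (e p).snd (e q).snd := dist_nonneg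
  exact abs_le_of_sq_le_sq' (by nlinarith [dist_sq_chart e p q]) (by positivity) |>.2

theorem dist_chartPoint_le (e : CartesianChart n) (x y : EuclideanSpace ℝ (Fin (n - 1)))
    (s t : ℝ) : dist (chartPoint e x s) (chartPoint e y t) ≤ dist x y + |s - t| := by
  simpa [Real.dist_eq] using dist_le_chart e (chartPoint e x s) (chartPoint e y t)

theorem continuous_chart_fst (e : CartesianChart n) :
    Continuous fun p : EuclideanSpace ℝ (Fin n) => (e p).fst :=
  (WithLp.prod_continuous_ofLp 2 _ _).fst.comp e.continuous

theorem continuous_chart_snd (e : CartesianChart n) :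
    Continuous fun p : EuclideanSpace ℝ (Fin n) => (e p).snd :=
  (WithLp.prod_continuous_ofLp 2 _ _).snd.comp e.continuous

/-- Any vector can be made vertical by a choice of Cartesian coordinates. -/
theorem exists_linearIsometryEquiv_vertical (hn : 1 ≤ n) (v : EuclideanSpace ℝ (Fin n)) :
    ∃ f : EuclideanSpace ℝ (Fin n) ≃ₗᵢ[ℝ] WithLp 2 (EuclideanSpace ℝ (Fin (n - 1)) × ℝ),
      f v = WithLp.toLp 2 (0, ‖v‖) := by
  have hfin : Module.finrank ℝ (EuclideanSpace ℝ (Fin n)) =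
      Module.finrank ℝ (WithLp 2 (EuclideanSpace ℝ (Fin (n - 1)) × ℝ)) := by
    rw [(WithLp.linearEquiv 2 ℝ (EuclideanSpace ℝ (Fin (n - 1)) × ℝ)).finrank_eq]
    simp [Module.finrank_prod]
    omega
  let f₀ := (stdOrthonormalBasis ℝ (EuclideanSpace ℝ (Fin n))).repr.trans
    ((stdOrthonormalBasis ℝ (WithLp 2 (EuclideanSpace ℝ (Fin (n - 1)) × ℝ))).reindex
      (finCongr hfin.symm)).repr.symm
  let u : WithLp 2 (EuclideanSpace ℝ (Fin (n - 1)) × ℝ) := WithLp.toLp 2 (0, ‖v‖)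
  have hu : ‖f₀ v‖ = ‖u‖ := by
    simp [u]
  -- Reflection in the hyperplane orthogonal to the difference of two vectors of equal norm swaps
  -- them.
  exact ⟨f₀.trans (Submodule.reflection (ℝ ∙ (f₀ v - u))ᗮ), by
    simpa using Submodule.reflection_sub hu⟩

theorem exists_chart_vertical (hn : 1 ≤ n) (a v : EuclideanSpace ℝ (Fin n)) :
    ∃ e : CartesianChart n, ∀ (p : EuclideanSpace ℝ (Fin n)) (t : ℝ),
      chartPoint e 0 0 = a ∧ (e (p + t • v)).fst = (e p).fst ∧
      (e (p + t • v)).snd = (e p).snd + t * ‖v‖ := by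
  obtain ⟨f, hf⟩ := exists_linearIsometryEquiv_vertical hn v
  refine ⟨(AffineIsometryEquiv.constVAdd ℝ _ (-a)).trans f.toAffineIsometryEquiv,
    fun p t => ⟨?_, ?_, ?_⟩⟩
  · have h0 : (WithLp.toLp 2 ((0 : EuclideanSpace ℝ (Fin (n - 1))), (0 : ℝ))) = 0 := rfl
    rw [chartPoint, AffineIsometryEquiv.symm_apply_eq]
    simp [h0]
  · simp [hf]
  · simp [hf, add_assoc]

theorem exists_chart_through (hn : 1 ≤ n) (A B : EuclideanSpace ℝ (Fin n)) :
    ∃ e : CartesianChart n, chartPoint e 0 0 = A ∧ chartPoint e 0 (dist A B) = B := by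
  obtain ⟨e, he⟩ := exists_chart_vertical hn A (B - A)
  have hA : chartPoint e 0 0 = A := (he 0 0).1
  have hA1 : (e A).fst = 0 := by rw [← hA]; simp
  have hA2 : (e A).snd = 0 := by rw [← hA]; simp
  have h1 := (he A 1).2
  rw [one_smul, one_mul, add_sub_cancel, hA1, hA2, zero_add, ← dist_eq_norm, dist_comm] at h1
  refine ⟨e, hA, ?_⟩
  rw [← h1.1, ← h1.2, chartPoint_chart]

theorem dist_chartPoint_lt_of_mem_Icc (e : CartesianChart n) {x : EuclideanSpace ℝ (Fin (n - 1))}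
    {p : EuclideanSpace ℝ (Fin n)} {ℓ t ρ : ℝ} (h0 : dist (chartPoint e x 0) p < ρ)
    (h1 : dist (chartPoint e x ℓ) p < ρ) (ht : t ∈ Icc 0 ℓ) : dist (chartPoint e x t) p < ρ := by
  have key : ∀ s, dist (chartPoint e x s) p ^ 2 = dist x (e p).fst ^ 2 + (s - (e p).snd) ^ 2 :=
    fun s => by simpa [Real.dist_eq] using dist_sq_chart e (chartPoint e x s) p
  have hρ : 0 < ρ := dist_nonneg.trans_lt h0
  refine lt_of_pow_lt_pow_left₀ 2 hρ.le ?_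
  have e0 := pow_lt_pow_left₀ h0 dist_nonneg two_ne_zero
  have e1 := pow_lt_pow_left₀ h1 dist_nonneg two_ne_zero
  rw [key] at e0 e1 ⊢
  rcases le_total t (e p).snd with h | h
  · nlinarith [ht.1]
  · nlinarith [ht.2]

/-- The projection is 1-Lipschitz. Every lower bound on boundary measure below comes from a set that
vertical lines over a ball are forced to meet. -/
theorem volume_image_chart_fst_le (e : CartesianChart n) (T : Set (EuclideanSpace ℝ (Fin n))) :
    volume ((fun p => (e p).fst) '' T) ≤ μHE[n - 1] T := by
  have hl : LipschitzWith 1 fun p : EuclideanSpace ℝ (Fin n) => (e p).fst :=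
    LipschitzWith.of_dist_le_mul fun p q => by simpa using dist_chart_fst_le e p q
  rw [← EuclideanSpace.euclideanHausdorffMeasure_eq_volume]
  simp only [Measure.euclideanHausdorffMeasure_def, Measure.smul_apply]
  gcongr
  simpa using hl.hausdorffMeasure_image_le (d := ((n - 1 : ℕ) : ℝ)) (by positivity) T

/-- An open set that is stable under translations by an open cone of directions around `v` is
the region above a Lipschitz graph. -/
theorem exists_eq_aboveGraph_of_cone (hn : 1 ≤ n) {U : Set (EuclideanSpace ℝ (Fin n))}
    (hU : IsOpen U) {v : EuclideanSpace ℝ (Fin n)} {K : ℝ≥0} (hK : ‖v‖ ≤ K)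
    (hcone : ∀ p ∈ U, ∀ t : ℝ, 0 < t → ∀ w : EuclideanSpace ℝ (Fin n), ‖w‖ ≤ t →
      p + t • v + w ∈ U) (hne : U.Nonempty) (hne' : Uᶜ.Nonempty) :
    ∃ (e : CartesianChart n) (φ : EuclideanSpace ℝ (Fin (n - 1)) → ℝ),
      LipschitzWith K φ ∧ U = aboveGraph e φ := by
  -- With `v = 0` the cone condition would put balls of every radius in `U`, so that `U` would be
  -- everything.
  have hv : 0 < ‖v‖ := by
    rw [norm_pos_iff]
    rintro rfl
    obtain ⟨p, hp⟩ := hne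
    obtain ⟨q, hq⟩ := hne'
    apply hq
    have := hcone p hp (‖q - p‖ + 1) (by positivity) (q - p) (by linarith)
    simpa using this
  obtain ⟨e, he⟩ := exists_chart_vertical hn 0 v
  have hmove : ∀ (x y : EuclideanSpace ℝ (Fin (n - 1))) (s t : ℝ), chartPoint e x s ∈ U →
      K * dist x y < t - s → chartPoint e y t ∈ U := by
    intro x y s t hx hst
    have hτ : 0 < (t - s) / ‖v‖ := div_pos (lt_of_le_of_lt (by positivity) hst) hv
    have := hcone _ hx ((t - s) / ‖v‖) hτ
      (chartPoint e y t - (chartPoint e x s + ((t - s) / ‖v‖) • v)) ?_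
    · simpa using this
    · rw [← dist_eq_norm]
      refine (dist_le_chart e _ _).trans ?_
      rw [(he _ _).2.1, (he _ _).2.2]
      simp only [chart_chartPoint_fst, chart_chartPoint_snd]
      rw [div_mul_cancel₀ _ hv.ne', add_sub_cancel, dist_self, add_zero, le_div_iff₀ hv, dist_comm]
      nlinarith [dist_nonneg (x := x) (y := y)]
  have hup : ∀ x s t, chartPoint e x s ∈ U → s < t → chartPoint e x t ∈ U := fun x s t h hst =>
    hmove x x s t h (by simpa using hst)
  obtain ⟨p, hp⟩ := hne
  obtain ⟨q, hq⟩ := hne'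
  have hSne : ∀ x, {t | chartPoint e x t ∈ U}.Nonempty := fun x =>
    ⟨(e p).snd + (K * dist (e p).fst x + 1), hmove (e p).fst x (e p).snd _ (by simpa using hp)
      (by linarith)⟩
  have hSbdd : ∀ x, BddBelow {t | chartPoint e x t ∈ U} := fun x => by
    refine ⟨(e q).snd - (K * dist x (e q).fst + 1), fun t ht => ?_⟩
    by_contra! hlt
    exact hq (by simpa using hmove x (e q).fst t (e q).snd ht (by linarith))
  refine ⟨e, fun x => sInf {t | chartPoint e x t ∈ U}, ?_, ?_⟩
  · refine LipschitzWith.of_le_add_mul K fun x y => ?_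
    refine le_of_forall_pos_le_add fun ε hε => ?_
    obtain ⟨s, hs, hs'⟩ := exists_lt_of_csInf_lt (hSne y)
      (lt_add_of_pos_right (sInf {t | chartPoint e y t ∈ U}) (half_pos hε))
    have := csInf_le (hSbdd x) (hmove y x s (s + K * dist y x + ε / 2) hs (by linarith))
    rw [dist_comm y x] at this
    linarith
  · ext z
    simp only [aboveGraph, mem_ofPred_eq]
    constructor
    · intro hz
      have hopen : IsOpen {t | chartPoint e (e z).fst t ∈ U} :=
        hU.preimage ((continuous_chartPoint e).comp (Continuous.prodMk_right _))
      obtain ⟨ε, hε, hball⟩ := Metric.isOpen_iff.1 hopen (e z).snd (by simpa using hz)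
      have hmem : (e z).snd - ε / 2 ∈ {t | chartPoint e (e z).fst t ∈ U} :=
        hball (by rw [mem_ball, Real.dist_eq, abs_lt]; constructor <;> linarith)
      exact (csInf_le (hSbdd _) hmem).trans_lt (by linarith)
    · intro hz
      obtain ⟨s, hs, hs'⟩ := exists_lt_of_csInf_lt (hSne _) hz
      simpa using hup _ s _ hs hs'

end Charts

/-! ### Boundary crossings and lower regularity of the boundary -/

section Crossing

variable {n : ℕ}

theorem exists_mem_frontier_of_isPreconnected {X : Type*} [TopologicalSpace X] {U S : Set X}
    (hS : IsPreconnected S) {a b : X} (ha : a ∈ S) (hb : b ∈ S) (haU : a ∈ U) (hbU : b ∉ U) :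
    ∃ p ∈ S, p ∈ frontier U := by
  by_contra! h
  have hsub : S ⊆ interior U ∪ (closure U)ᶜ := fun p hp => by
    by_cases hc : p ∈ closure U
    · left
      by_contra hi
      exact h p hp ⟨hc, hi⟩
    · exact Or.inr hc
  obtain ⟨p, -, hp1, hp2⟩ := hS (interior U) (closure U)ᶜ isOpen_interior
    isClosed_closure.isOpen_compl hsub
    ⟨a, ha, (hsub ha).resolve_right fun h' => h' (subset_closure haU)⟩
    ⟨b, hb, (hsub hb).resolve_left fun h' => hbU (interior_subset h')⟩
  exact hp2 (subset_closure (interior_subset hp1))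

theorem IsNontangentialPoint.ball_subset {U : Set (EuclideanSpace ℝ (Fin n))} {M r : ℝ}
    {Q A : EuclideanSpace ℝ (Fin n)} (h : IsNontangentialPoint U M Q r A) :
    ball A (r / M) ⊆ U := by
  intro y hy
  by_contra hyU
  have hpos : 0 < r / M := dist_nonneg.trans_lt hy
  obtain ⟨p, hp, hpf⟩ := exists_mem_frontier_of_isPreconnected
    (convex_ball A (r / M)).isPreconnected (mem_ball_self hpos) hy h.1 hyU
  have := infDist_le_dist_of_mem (x := A) hpf
  rw [mem_ball'] at hp
  linarith [h.2.2]

/-- Segments parallel to the line joining the interior and exterior corkscrew points, and close to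
it, run from one corkscrew ball to the other and so cross the boundary. Corkscrews at scale `s / 2`
leave room for these segments inside `ball p s`. -/
theorem IsCorkscrewDomain.volume_ball_le_measure_frontier (hn : 1 ≤ n)
    {Ω : Set (EuclideanSpace ℝ (Fin n))} {M R : ℝ} (hM : 1 < M) (hΩ : IsCorkscrewDomain Ω M R)
    {p : EuclideanSpace ℝ (Fin n)} (hp : p ∈ frontier Ω) {s : ℝ} (hs : 0 < s) (hsR : s < R) :
    volume (ball (0 : EuclideanSpace ℝ (Fin (n - 1))) (s / (2 * M))) ≤
      μHE[n - 1] (frontier Ω ∩ ball p s) := by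
  obtain ⟨A, hA⟩ := hΩ.interior_corkscrew p hp (s / 2) (by linarith) (by linarith)
  obtain ⟨B, hB⟩ := hΩ.exterior_corkscrew p hp (s / 2) (by linarith) (by linarith)
  obtain ⟨e, hA0, hB0⟩ := exists_chart_through hn A B
  refine le_trans (measure_mono ?_) (volume_image_chart_fst_le e _)
  have hsM : s / (2 * M) = s / 2 / M := by field_simp
  have hsM' : s / (2 * M) ≤ s / 2 := by
    gcongr; linarith
  intro x hx
  rw [mem_ball] at hx
  have hxA : chartPoint e x 0 ∈ Ω := hA.ball_subset <| by
    rw [mem_ball, ← hsM, ← hA0]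
    exact (dist_chartPoint_le e _ _ _ _).trans_lt (by simpa using hx)
  have hxB : chartPoint e x (dist A B) ∉ Ω := fun hmem => by
    refine hB.ball_subset (a := chartPoint e x (dist A B)) ?_ (subset_closure hmem)
    rw [mem_ball, ← hsM]
    nth_rewrite 2 [← hB0]
    exact (dist_chartPoint_le e _ _ _ _).trans_lt (by simpa using hx)
  have hconn : IsPreconnected (chartPoint e x '' Icc 0 (dist A B)) :=
    isPreconnected_Icc.image _
      ((continuous_chartPoint e).comp (Continuous.prodMk_right x)).continuousOn
  obtain ⟨q, ⟨t, ht, rfl⟩, hq⟩ := exists_mem_frontier_of_isPreconnected hconn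
    ⟨0, ⟨le_rfl, dist_nonneg⟩, rfl⟩ ⟨(dist A B), ⟨dist_nonneg, le_rfl⟩, rfl⟩ hxA hxB
  refine ⟨chartPoint e x t, ⟨hq, ?_⟩, by simp⟩
  have h1 : dist (chartPoint e 0 t) p < s / 2 :=
    dist_chartPoint_lt_of_mem_Icc e (hA0 ▸ hA.2.1) (hB0.symm ▸ hB.2.1) ht
  have h2 : dist (chartPoint e x t) (chartPoint e 0 t) ≤ dist x 0 := by
    simpa using dist_chartPoint_le e x 0 t t
  have h3 := dist_triangle (chartPoint e x t) (chartPoint e 0 t) p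
  rw [mem_ball]
  linarith

end Crossing

/-! ### Vitali covering and covering numbers -/

section Covering

/-- If every point of `S` is the centre of a ball on which `m` controls the volume, then `m`
controls the volume of `S`. -/
theorem volume_le_of_forall_exists_closedBall {d : ℕ} {m : Measure (EuclideanSpace ℝ (Fin d))}
    {S : Set (EuclideanSpace ℝ (Fin d))} {A : ℝ≥0∞} {R : ℝ}
    (h : ∀ x ∈ S, ∃ ρ, 0 < ρ ∧ ρ ≤ R ∧
      volume (ball (0 : EuclideanSpace ℝ (Fin d)) ρ) ≤ A * m (closedBall x ρ)) :
    volume S ≤ 4 ^ d * A * m univ := by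
  choose! ρ hρ hρR hm using h
  -- The enlargement factor 4 of the Vitali covering gives the `4 ^ d`; no measurability of `S` is
  -- needed.
  obtain ⟨u, huS, hdisj, hcov⟩ := Vitali.exists_disjoint_subfamily_covering_enlargement_closedBall
    S id ρ R hρR 4 (by norm_num)
  have hcount : u.Countable := hdisj.countable_of_nonempty_interior fun x hx => by
    exact ⟨x, ball_subset_interior_closedBall (mem_ball_self (hρ x (huS hx)))⟩
  have hvol : ∀ x ∈ u, volume (closedBall x (4 * ρ x)) ≤ 4 ^ d * A * m (closedBall x (ρ x)) := by
    intro x hx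
    have h0 := hρ x (huS hx)
    rw [Measure.addHaar_closedBall_mul_of_pos _ _ (by norm_num), finrank_euclideanSpace_fin,
      Measure.addHaar_closedBall_center, mul_assoc,
      ENNReal.ofReal_pow (by norm_num), ENNReal.ofReal_ofNat]
    gcongr
    refine le_trans (le_of_eq ?_) (hm x (huS hx))
    rw [Measure.addHaar_closedBall _ _ h0.le, Measure.addHaar_ball_of_pos _ _ h0]
  calc volume S ≤ volume (⋃ x ∈ u, closedBall x (4 * ρ x)) := by
        refine measure_mono fun x hx => ?_
        obtain ⟨b, hb, hsub⟩ := hcov x hx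
        exact mem_biUnion hb (hsub (mem_closedBall_self (hρ x hx).le))
    _ ≤ ∑' x : u, volume (closedBall (x : EuclideanSpace ℝ (Fin d)) (4 * ρ x)) :=
        measure_biUnion_le _ hcount _
    _ ≤ ∑' x : u, 4 ^ d * A * m (closedBall (x : EuclideanSpace ℝ (Fin d)) (ρ x)) :=
        ENNReal.tsum_le_tsum fun x => hvol x x.2
    _ = 4 ^ d * A * m (⋃ x ∈ u, closedBall x (ρ x)) := by
        rw [ENNReal.tsum_mul_left]
        exact congrArg _ (measure_biUnion hcount hdisj fun _ _ => measurableSet_closedBall).symm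
    _ ≤ 4 ^ d * A * m univ := by
        gcongr
        exact subset_univ _

/-- The number of balls of radius `c * r` centred on a subset of a ball of radius `r` that are
needed to cover this subset is bounded in terms of `c`. -/
theorem exists_covering_number (n : ℕ) {c : ℝ} (hc : 0 < c) :
    ∃ N : ℕ, ∀ (Q : EuclideanSpace ℝ (Fin n)) (r : ℝ), 0 < r →
      ∀ F ⊆ closedBall Q r, F.Nonempty →
      ∃ p : Fin N → EuclideanSpace ℝ (Fin n), (∀ i, p i ∈ F) ∧ F ⊆ ⋃ i, ball (p i) (c * r) := by
  obtain ⟨t, -, htf, hcov⟩ := finite_cover_balls_of_compact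
    (isCompact_closedBall (0 : EuclideanSpace ℝ (Fin n)) 1) (half_pos hc)
  obtain ⟨N, f, hf⟩ : ∃ N, ∃ f : Fin N → EuclideanSpace ℝ (Fin n), range f = t := by
    have := htf.to_subtype
    exact ⟨_, Subtype.val ∘ (Finite.equivFin t).symm, by
      rw [range_comp, (Finite.equivFin t).symm.range_eq_univ, image_univ, Subtype.range_coe]⟩
  refine ⟨N, fun Q r hr F hF hne => ?_⟩
  classical
  obtain ⟨q, hq⟩ := hne
  -- Centres of a `c / 2`-net are moved into `F`; those whose balls miss `F` are replaced by an
  -- arbitrary point of `F`.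
  let p : Fin N → EuclideanSpace ℝ (Fin n) := fun i =>
    if h : (F ∩ ball (Q + r • f i) (c / 2 * r)).Nonempty then h.some else q
  refine ⟨p, fun i => ?_, fun x hx => ?_⟩
  · by_cases h : (F ∩ ball (Q + r • f i) (c / 2 * r)).Nonempty
    · simp only [p, h, dite_true]
      exact h.some_mem.1
    · simpa only [p, h, dite_false] using hq
  · have hx1 : r⁻¹ • (x - Q) ∈ closedBall (0 : EuclideanSpace ℝ (Fin n)) 1 := by
      have := hF hx
      rw [mem_closedBall, dist_eq_norm] at this
      rw [mem_closedBall_zero_iff, norm_smul, norm_inv, Real.norm_of_nonneg hr.le,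
        inv_mul_le_iff₀ hr]
      simpa using this
    obtain ⟨y, hy, hxy⟩ := mem_iUnion₂.1 (hcov hx1)
    obtain ⟨i, rfl⟩ : y ∈ range f := hf ▸ hy
    have hxi : x ∈ ball (Q + r • f i) (c / 2 * r) := by
      rw [mem_ball, dist_eq_norm] at hxy ⊢
      have : x - (Q + r • f i) = r • (r⁻¹ • (x - Q) - f i) := by
        rw [smul_sub, smul_inv_smul₀ hr.ne']
        abel
      rw [this, norm_smul, Real.norm_of_nonneg hr.le]
      nlinarith
    have h : (F ∩ ball (Q + r • f i) (c / 2 * r)).Nonempty := ⟨x, hx, hxi⟩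
    have hpi : p i ∈ ball (Q + r • f i) (c / 2 * r) := by
      simp only [p, h, dite_true]
      exact h.some_mem.2
    refine mem_iUnion.2 ⟨i, ?_⟩
    rw [mem_ball] at *
    have := dist_triangle_right x (p i) (Q + r • f i)
    linarith

end Covering

/-! ### The region below a graph over a cube is a Lipschitz domain -/

section GraphDomain

variable {n : ℕ}

/-- The part of the region below the graph of `φ` over a cube of half-side `δ` that is above
the height `-b`. -/
def cubeBelowGraph (e : CartesianChart n) (φ : EuclideanSpace ℝ (Fin (n - 1)) → ℝ) (δ b : ℝ) :
    Set (EuclideanSpace ℝ (Fin n)) :=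
  {p | (∀ i, |(e p).fst i| < δ) ∧ -b < (e p).snd ∧ (e p).snd < φ (e p).fst}

variable {e : CartesianChart n} {φ : EuclideanSpace ℝ (Fin (n - 1)) → ℝ} {δ b : ℝ}

theorem continuous_chart_fst_apply (e : CartesianChart n) (i : Fin (n - 1)) :
    Continuous fun p : EuclideanSpace ℝ (Fin n) => (e p).fst i :=
  (EuclideanSpace.proj (𝕜 := ℝ) i).continuous.comp (continuous_chart_fst e)

theorem isOpen_cubeBelowGraph (hφ : Continuous φ) : IsOpen (cubeBelowGraph e φ δ b) := by
  have h : cubeBelowGraph e φ δ b = (⋂ i, {p | |(e p).fst i| < δ}) ∩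
      ({p | -b < (e p).snd} ∩ {p | (e p).snd < φ (e p).fst}) := by
    ext p
    simp [cubeBelowGraph]
  rw [h]
  exact (isOpen_iInter_of_finite fun i =>
    isOpen_lt (continuous_chart_fst_apply e i).abs continuous_const).inter
    ((isOpen_lt continuous_const (continuous_chart_snd e)).inter
      (isOpen_lt (continuous_chart_snd e) (hφ.comp (continuous_chart_fst e))))

theorem closure_cubeBelowGraph_subset (hφ : Continuous φ) :
    closure (cubeBelowGraph e φ δ b) ⊆
      {p | (∀ i, |(e p).fst i| ≤ δ) ∧ -b ≤ (e p).snd ∧ (e p).snd ≤ φ (e p).fst} := by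
  refine closure_minimal (fun p hp => ⟨fun i => (hp.1 i).le, hp.2.1.le, hp.2.2.le⟩) ?_
  have h : {p | (∀ i, |(e p).fst i| ≤ δ) ∧ -b ≤ (e p).snd ∧ (e p).snd ≤ φ (e p).fst} =
      (⋂ i, {p | |(e p).fst i| ≤ δ}) ∩
      ({p | -b ≤ (e p).snd} ∩ {p | (e p).snd ≤ φ (e p).fst}) := by
    ext p
    simp
  rw [h]
  exact (isClosed_iInter fun i =>
    isClosed_le (continuous_chart_fst_apply e i).abs continuous_const).inter
    ((isClosed_le continuous_const (continuous_chart_snd e)).inter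
      (isClosed_le (continuous_chart_snd e) (hφ.comp (continuous_chart_fst e))))

/-- Move vertically to height 0, then radially to the origin; `0 < φ` keeps the height-0 slice
inside the region. -/
theorem isConnected_cubeBelowGraph (hδ : 0 < δ) (hb : 0 < b) (hφ : ∀ x, 0 < φ x) :
    IsConnected (cubeBelowGraph e φ δ b) := by
  have h0 : chartPoint e 0 0 ∈ cubeBelowGraph e φ δ b := by
    simp [cubeBelowGraph, hδ, hb, hφ]
  refine ⟨⟨_, h0⟩, isPreconnected_of_forall (chartPoint e 0 0) fun p hp => ?_⟩
  set x := (e p).fst with hx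
  refine ⟨chartPoint e x '' Ioo (-b) (φ x) ∪ (fun c : ℝ => chartPoint e (c • x) 0) '' Icc 0 1,
    ?_, Or.inr ⟨0, by simp, by simp⟩, Or.inl ⟨(e p).snd, hp.2, by simp [x]⟩, ?_⟩
  · rintro _ (⟨t, ht, rfl⟩ | ⟨c, hc, rfl⟩)
    · simpa [cubeBelowGraph] using ⟨hp.1, ht⟩
    · refine ⟨fun i => ?_, by simpa using hb, by simpa using hφ _⟩
      have := hp.1 i
      simp only [chart_chartPoint_fst, PiLp.smul_apply, smul_eq_mul, abs_mul, abs_of_nonneg hc.1]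
      nlinarith [hc.2, abs_nonneg (x i)]
  · refine IsPreconnected.union (chartPoint e x 0) ⟨0, ⟨by linarith, hφ x⟩, rfl⟩
      ⟨1, by simp, by simp⟩ ?_ ?_
    · exact isPreconnected_Ioo.image _
        ((continuous_chartPoint e).comp (Continuous.prodMk_right x)).continuousOn
    · exact isPreconnected_Icc.image _ ((continuous_chartPoint e).comp
        ((continuous_id.smul continuous_const).prodMk continuous_const)).continuousOn

theorem chart_add (e : CartesianChart n) (p u : EuclideanSpace ℝ (Fin n)) :
    e (p + u) = e p + e.linearIsometryEquiv u := by
  rw [add_comm, ← vadd_eq_add, e.map_vadd, vadd_eq_add, add_comm]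

/-- A region cut out by the half-spaces of an orthant and one more monotone constraint is the
region above a Lipschitz graph. -/
theorem exists_eq_aboveGraph_of_orthant (hn : 1 ≤ n) (e : CartesianChart n)
    {σ : EuclideanSpace ℝ (Fin (n - 1))} (hσ : ∀ i, |σ i| = 1) {β B : ℝ≥0} {ς : ℝ}
    (hς : |ς| = β) (hB : n + β ≤ B) {g : EuclideanSpace ℝ (Fin n) → ℝ} (hg : Continuous g)
    (hmono : ∀ p q : EuclideanSpace ℝ (Fin n), ∀ t : ℝ, 0 < t →
      dist (e q).fst (e p).fst ≤ t * (n + 1) → |(e q).snd - (e p).snd - t * ς| ≤ t → g p ≤ g q)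
    (hne : {p | (∀ i, σ i * (e p).fst i < δ) ∧ 0 < g p}.Nonempty)
    (hne' : {p | (∀ i, σ i * (e p).fst i < δ) ∧ 0 < g p}ᶜ.Nonempty) :
    ∃ (e' : CartesianChart n) (φ' : EuclideanSpace ℝ (Fin (n - 1)) → ℝ),
      LipschitzWith B φ' ∧ {p | (∀ i, σ i * (e p).fst i < δ) ∧ 0 < g p} = aboveGraph e' φ' := by
  have hσσ : ∀ i, σ i * σ i = 1 := fun i => by rw [← abs_mul_abs_self, hσ, one_mul]
  have hσn : ‖σ‖ ≤ n := by
    rw [EuclideanSpace.norm_eq, Real.sqrt_le_left (by positivity)]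
    have h1 : ((n - 1 : ℕ) : ℝ) ≤ n := by exact_mod_cast Nat.sub_le n 1
    have h2 : (1 : ℝ) ≤ n := by exact_mod_cast hn
    simp only [Real.norm_eq_abs, hσ]
    simp
    nlinarith
  -- This direction points inward through all faces of the orthant at once, at unit rate in each
  -- coordinate, so an error `w` of size `t` cannot undo a move by `t • v`.
  set v : EuclideanSpace ℝ (Fin n) := e.linearIsometryEquiv.symm (WithLp.toLp 2 (-σ, ς)) with hv
  refine exists_eq_aboveGraph_of_cone hn (v := v) ?_ ?_ ?_ hne hne'
  · have h : {p | (∀ i, σ i * (e p).fst i < δ) ∧ 0 < g p} =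
        (⋂ i, {p | σ i * (e p).fst i < δ}) ∩ {p | 0 < g p} := by
      ext p
      simp
    rw [h]
    exact (isOpen_iInter_of_finite fun i =>
      isOpen_lt (continuous_const.mul (continuous_chart_fst_apply e i)) continuous_const).inter
      (isOpen_lt continuous_const hg)
  · have h2 : ‖v‖ ^ 2 = ‖σ‖ ^ 2 + |ς| ^ 2 := by
      rw [hv, LinearIsometryEquiv.norm_map, WithLp.prod_norm_sq_eq_of_L2]
      simp
    have h3 : (n : ℝ) + β ≤ B := by exact_mod_cast hB
    refine (abs_le_of_sq_le_sq' (b := (n : ℝ) + β) ?_ (by positivity)).2.trans h3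
    rw [h2, hς]
    nlinarith [norm_nonneg σ, β.2, mul_nonneg (Nat.cast_nonneg (α := ℝ) n) β.2]
  · rintro p ⟨hp1, hp2⟩ t ht w hw
    have hlv : e.linearIsometryEquiv v = WithLp.toLp 2 (-σ, ς) := by
      rw [hv, LinearIsometryEquiv.apply_symm_apply]
    set w' := e.linearIsometryEquiv w with hw'
    have hww : ‖w'.fst‖ ^ 2 + |w'.snd| ^ 2 ≤ t ^ 2 := by
      have h4 : ‖w'‖ ^ 2 = ‖w'.fst‖ ^ 2 + |w'.snd| ^ 2 := by
        simp [WithLp.prod_norm_sq_eq_of_L2]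
      rw [← h4, hw', LinearIsometryEquiv.norm_map]
      gcongr
    have hw1 : ‖w'.fst‖ ≤ t := (abs_le_of_sq_le_sq' (by nlinarith [sq_nonneg |w'.snd|]) ht.le).2
    have hw2 : |w'.snd| ≤ t := (abs_le_of_sq_le_sq' (by nlinarith [sq_nonneg ‖w'.fst‖]) ht.le).2
    have hfst : (e (p + t • v + w)).fst = (e p).fst + -(t • σ) + w'.fst := by
      rw [chart_add, chart_add, map_smul, hlv]
      simp [w']
    have hsnd : (e (p + t • v + w)).snd = (e p).snd + t * ς + w'.snd := by
      rw [chart_add, chart_add, map_smul, hlv]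
      simp [w']
    refine ⟨fun i => ?_, hp2.trans_le (hmono p _ t ht ?_ ?_)⟩
    · have h5 : σ i * w'.fst i ≤ t := by
        refine (le_abs_self _).trans ?_
        rw [abs_mul, hσ, one_mul, ← Real.norm_eq_abs]
        exact (PiLp.norm_apply_le _ i).trans hw1
      have h6 := hp1 i
      rw [hfst]
      simp only [PiLp.add_apply, PiLp.neg_apply, PiLp.smul_apply, smul_eq_mul]
      linear_combination h5 + h6 - t * hσσ i
    · rw [hfst, dist_eq_norm]
      have h7 : (e p).fst + -(t • σ) + w'.fst - (e p).fst = -(t • σ) + w'.fst := by abel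
      rw [h7]
      refine (norm_add_le _ _).trans ?_
      rw [norm_neg, norm_smul, Real.norm_of_nonneg ht.le]
      nlinarith
    · rw [hsnd]
      convert hw2 using 2
      ring

/-- In a small ball at most one of the two faces in each coordinate, and at most one of roof and
floor, is active. The region is thus locally an orthant with one more monotone constraint, hence
stable under a cone of directions. -/
theorem exists_localChart_cubeBelowGraph (hn : 1 ≤ n) {L : ℝ≥0} (hφ : LipschitzWith L φ)
    {h ρ : ℝ} (hρδ : 2 * ρ ≤ δ) (hρh : 4 * ((L + 1) * ρ) ≤ h + b) (hρ : 0 < ρ) (hh : ∀ x, h ≤ φ x)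
    {p : EuclideanSpace ℝ (Fin n)} (hp : p ∈ frontier (cubeBelowGraph e φ δ b)) :
    ∃ (e' : CartesianChart n) (φ' : EuclideanSpace ℝ (Fin (n - 1)) → ℝ),
      LipschitzWith (n + (n * L + L + 1)) φ' ∧
      cubeBelowGraph e φ δ b ∩ ball p (2 * ρ) = aboveGraph e' φ' ∩ ball p (2 * ρ) := by
  have hopen := isOpen_cubeBelowGraph (e := e) (δ := δ) (b := b) hφ.continuous
  obtain ⟨hp1, hp2, hp3⟩ := closure_cubeBelowGraph_subset hφ.continuous (frontier_subset_closure hp)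
  have hpD : p ∉ cubeBelowGraph e φ δ b := fun h' => by
    rw [hopen.frontier_eq] at hp
    exact hp.2 h'
  have hpball : p ∈ ball p (2 * ρ) := mem_ball_self (by linarith)
  obtain ⟨p₀, hp₀, hp₀'⟩ := mem_closure_iff.1 (frontier_subset_closure hp) _ isOpen_ball hpball
  let σ : EuclideanSpace ℝ (Fin (n - 1)) := WithLp.toLp 2 fun i => if 0 ≤ (e p).fst i then 1 else -1
  have hσ : ∀ i, |σ i| = 1 := fun i => by
    by_cases h0 : 0 ≤ (e p).fst i <;> simp [σ, h0]
  have hside : ∀ q ∈ ball p (2 * ρ), (∀ i, |(e q).fst i| < δ) ↔ ∀ i, σ i * (e q).fst i < δ := by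
    intro q hq
    refine forall_congr' fun i => ?_
    have hqi : |(e q).fst i - (e p).fst i| < 2 * ρ := by
      refine lt_of_le_of_lt ?_ ((dist_chart_fst_le e q p).trans_lt hq)
      rw [dist_eq_norm]
      exact PiLp.norm_apply_le ((e q).fst - (e p).fst) i
    rw [abs_lt] at hqi
    rw [abs_lt]
    by_cases h0 : 0 ≤ (e p).fst i
    · simp only [σ, h0, if_true, one_mul]
      exact ⟨fun h => h.2, fun h => ⟨by linarith, h⟩⟩
    · simp only [σ, h0, if_false]
      push Not at h0
      exact ⟨fun h => by linarith [h.1], fun h => ⟨by linarith, by linarith⟩⟩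
  have hφd : ∀ x y, |φ x - φ y| ≤ L * dist x y := fun x y => by
    simpa [Real.dist_eq] using hφ.dist_le_mul x y
  have hL : (0 : ℝ) ≤ L := L.2
  suffices H : ∃ (ς : ℝ) (g : EuclideanSpace ℝ (Fin n) → ℝ), |ς| = ((n * L + L + 1 : ℝ≥0) : ℝ) ∧
      Continuous g ∧ (∀ p q : EuclideanSpace ℝ (Fin n), ∀ t : ℝ, 0 < t →
      dist (e q).fst (e p).fst ≤ t * (n + 1) → |(e q).snd - (e p).snd - t * ς| ≤ t → g p ≤ g q) ∧
      ∀ q ∈ ball p (2 * ρ), (-b < (e q).snd ∧ (e q).snd < φ (e q).fst) ↔ 0 < g q by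
    obtain ⟨ς, g, hς, hg, hmono, hgq⟩ := H
    have hUD : ∀ q ∈ ball p (2 * ρ), q ∈ cubeBelowGraph e φ δ b ↔
        q ∈ {q | (∀ i, σ i * (e q).fst i < δ) ∧ 0 < g q} := fun q hq =>
      and_congr (hside q hq) (hgq q hq)
    obtain ⟨e', φ', hφ', hU⟩ := exists_eq_aboveGraph_of_orthant (δ := δ) hn e hσ hς le_rfl hg hmono
      ⟨p₀, (hUD p₀ hp₀).1 hp₀'⟩ ⟨p, fun h' => hpD ((hUD p hpball).2 h')⟩
    refine ⟨e', φ', hφ', ?_⟩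
    rw [← hU]
    ext q
    exact and_congr_left (hUD q)
  -- Keep the nearer of roof and floor. The other is at vertical distance at least `(h + b) / 2 ≥ 2
  -- * (L + 1) * ρ`, which is out of reach in the ball.
  rcases le_total (φ (e p).fst - (e p).snd) ((e p).snd + b) with hcase | hcase
  · refine ⟨-(n * L + L + 1), fun q => φ (e q).fst - (e q).snd, ?_, ?_, ?_, ?_⟩
    · rw [abs_neg, abs_of_nonneg (by positivity)]
      simp
    · exact (hφ.continuous.comp (continuous_chart_fst e)).sub (continuous_chart_snd e)
    · intro p q t ht h1 h2
      have h3 := abs_le.1 (hφd (e q).fst (e p).fst)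
      have h4 := abs_le.1 h2
      nlinarith
    · intro q hq
      have h1 := (dist_chart_snd_le e q p).trans_lt hq
      rw [Real.dist_eq, abs_lt] at h1
      have := hh (e p).fst
      rw [sub_pos]
      exact ⟨fun h' => h'.2, fun h' => ⟨by nlinarith, h'⟩⟩
  · refine ⟨n * L + L + 1, fun q => (e q).snd + b, ?_, ?_, ?_, ?_⟩
    · rw [abs_of_nonneg (by positivity)]
      simp
    · exact (continuous_chart_snd e).add continuous_const
    · intro p q t ht h1 h2
      have h4 := abs_le.1 h2
      have : 0 ≤ t * (n * L + L) := by positivity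
      linarith
    · intro q hq
      have h1 := (dist_chart_snd_le e q p).trans_lt hq
      have h2 := (dist_chart_fst_le e q p).trans_lt hq
      rw [Real.dist_eq, abs_lt] at h1
      have h3 := abs_le.1 (hφd (e q).fst (e p).fst)
      have := hh (e p).fst
      refine ⟨fun h' => by linarith [h'.1], fun h' => ⟨by linarith, by nlinarith⟩⟩

theorem isLipschitzDomain_cubeBelowGraph (hn : 1 ≤ n) {L : ℝ≥0} (hφ : LipschitzWith L φ)
    {h c r : ℝ} (hρδ : 2 * (c * r) ≤ δ) (hρh : 4 * ((L + 1) * (c * r)) ≤ h + b) (hρ : 0 < c * r)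
    (hh : ∀ x, h ≤ φ x) (hb : 0 < b) (hh0 : 0 < h) {N : ℕ} {Q : EuclideanSpace ℝ (Fin n)}
    (hN : ∀ F ⊆ closedBall Q r, F.Nonempty →
      ∃ p : Fin N → EuclideanSpace ℝ (Fin n), (∀ i, p i ∈ F) ∧ F ⊆ ⋃ i, ball (p i) (c * r))
    (hD : cubeBelowGraph e φ δ b ⊆ ball Q r) :
    IsLipschitzDomain (cubeBelowGraph e φ δ b) (n + (n * L + L + 1)) N (c * r) where
  isOpen := isOpen_cubeBelowGraph hφ.continuous
  isConnected := isConnected_cubeBelowGraph (by linarith) hb fun x => hh0.trans_le (hh x)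
  isBounded := isBounded_ball.subset hD
  radius_pos := hρ
  exists_charts := by
    have hne : (cubeBelowGraph e φ δ b).Nonempty :=
      (isConnected_cubeBelowGraph (by linarith) hb fun x => hh0.trans_le (hh x)).nonempty
    have : Nonempty (Fin n) := ⟨⟨0, hn⟩⟩
    have hfr : (frontier (cubeBelowGraph e φ δ b)).Nonempty := by
      refine nonempty_frontier_iff.2 ⟨hne, fun huniv => ?_⟩
      have hbd : Bornology.IsBounded (univ : Set (EuclideanSpace ℝ (Fin n))) :=
        huniv ▸ isBounded_ball.subset hD
      exact NoncompactSpace.noncompact_univ (isCompact_of_isClosed_isBounded isClosed_univ hbd)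
    obtain ⟨p, hp, hcov⟩ := hN _ (frontier_subset_closure.trans
      ((closure_mono hD).trans closure_ball_subset_closedBall)) hfr
    exact ⟨p, hp, hcov, fun i => exists_localChart_cubeBelowGraph hn hφ hρδ hρh hρ hh (hp i)⟩

end GraphDomain

/-! ### Exit heights, discs inside the domain, and upcrossing points -/

section Column

variable {n : ℕ}

/-- In the coordinates `e`, the vertical segments over a `w`-ball that start at height `0` and end
at height `ℓ` start inside the open set `Ω`, end outside of it and stay close to `Q`. -/
structure IsCrossingColumn (e : CartesianChart n) (Ω : Set (EuclideanSpace ℝ (Fin n)))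
    (Q : EuclideanSpace ℝ (Fin n)) (r w ℓ : ℝ) : Prop where
  isOpen : IsOpen Ω
  width_pos : 0 < w
  two_width_lt : 2 * w < r
  length_nonneg : 0 ≤ ℓ
  length_lt : ℓ < r
  bottom_mem : ∀ x t, ‖x‖ + |t| < w → chartPoint e x t ∈ Ω
  top_notMem : ∀ x, ‖x‖ < w → chartPoint e x ℓ ∉ Ω
  dist_lt : ∀ x, ∀ t ∈ Icc 0 ℓ, dist (chartPoint e x t) Q < r / 2 + ‖x‖

/-- The height at which the vertical segment over `x` leaves `Ω` for the first time. -/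
noncomputable def exitHeight (e : CartesianChart n) (Ω : Set (EuclideanSpace ℝ (Fin n))) (ℓ : ℝ)
    (x : EuclideanSpace ℝ (Fin (n - 1))) : ℝ :=
  sInf {t | t ∈ Icc 0 ℓ ∧ chartPoint e x t ∉ Ω}

theorem continuous_chartPoint_right (e : CartesianChart n) (x : EuclideanSpace ℝ (Fin (n - 1))) :
    Continuous (chartPoint e x) :=
  (continuous_chartPoint e).comp (Continuous.prodMk_right x)

theorem continuous_chartPoint_left (e : CartesianChart n) (t : ℝ) :
    Continuous fun x => chartPoint e x t :=
  (continuous_chartPoint e).comp (Continuous.prodMk_left t)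

/-- The first point outside of the open set `Ω` on a vertical segment that ends outside of `Ω`. -/
theorem exists_first_exit {e : CartesianChart n} {Ω : Set (EuclideanSpace ℝ (Fin n))}
    (hΩ : IsOpen Ω) {x : EuclideanSpace ℝ (Fin (n - 1))} {t₀ t₁ : ℝ} (h01 : t₀ ≤ t₁)
    (h1 : chartPoint e x t₁ ∉ Ω) :
    sInf {t | t ∈ Icc t₀ t₁ ∧ chartPoint e x t ∉ Ω} ∈ Icc t₀ t₁ ∧
      chartPoint e x (sInf {t | t ∈ Icc t₀ t₁ ∧ chartPoint e x t ∉ Ω}) ∉ Ω ∧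
      ∀ t, t₀ ≤ t → t < sInf {t | t ∈ Icc t₀ t₁ ∧ chartPoint e x t ∉ Ω} →
        chartPoint e x t ∈ Ω := by
  have hclosed : IsClosed {t | t ∈ Icc t₀ t₁ ∧ chartPoint e x t ∉ Ω} :=
    isClosed_Icc.inter (hΩ.isClosed_compl.preimage (continuous_chartPoint_right e x))
  have hbdd : BddBelow {t | t ∈ Icc t₀ t₁ ∧ chartPoint e x t ∉ Ω} := ⟨t₀, fun t ht => ht.1.1⟩
  have hmem := hclosed.csInf_mem ⟨t₁, ⟨h01, le_rfl⟩, h1⟩ hbdd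
  refine ⟨hmem.1, hmem.2, fun t ht ht' => ?_⟩
  by_contra hn
  exact (csInf_le hbdd ⟨⟨ht, ht'.le.trans hmem.1.2⟩, hn⟩).not_gt ht'

namespace IsCrossingColumn

variable {e : CartesianChart n} {Ω : Set (EuclideanSpace ℝ (Fin n))}
  {Q : EuclideanSpace ℝ (Fin n)} {r w ℓ : ℝ} (H : IsCrossingColumn e Ω Q r w ℓ)
  {x : EuclideanSpace ℝ (Fin (n - 1))}

include H

theorem exitHeight_mem_Icc (hx : ‖x‖ < w) : exitHeight e Ω ℓ x ∈ Icc 0 ℓ :=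
  (exists_first_exit H.isOpen H.length_nonneg (H.top_notMem x hx)).1

theorem chartPoint_exitHeight_notMem (hx : ‖x‖ < w) :
    chartPoint e x (exitHeight e Ω ℓ x) ∉ Ω :=
  (exists_first_exit H.isOpen H.length_nonneg (H.top_notMem x hx)).2.1

theorem chartPoint_mem_of_lt_exitHeight (hx : ‖x‖ < w) {t : ℝ} (ht : 0 ≤ t)
    (ht' : t < exitHeight e Ω ℓ x) : chartPoint e x t ∈ Ω :=
  (exists_first_exit H.isOpen H.length_nonneg (H.top_notMem x hx)).2.2 t ht ht'

/-- This uniform lower bound passes to the Lipschitz minorant and keeps its graph away from the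
floor. -/
theorem half_width_le_exitHeight (hx : ‖x‖ < w / 2) : w / 2 ≤ exitHeight e Ω ℓ x := by
  have hw := H.width_pos
  by_contra! h
  have h0 := (H.exitHeight_mem_Icc (x := x) (by linarith)).1
  refine H.chartPoint_exitHeight_notMem (x := x) (by linarith) (H.bottom_mem x _ ?_)
  rw [abs_of_nonneg h0]
  linarith

theorem chartPoint_exitHeight_mem_frontier (hx : ‖x‖ < w / 2) :
    chartPoint e x (exitHeight e Ω ℓ x) ∈ frontier Ω := by
  have hw := H.width_pos
  have h0 := H.half_width_le_exitHeight hx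
  rw [H.isOpen.frontier_eq]
  refine ⟨?_, H.chartPoint_exitHeight_notMem (by linarith)⟩
  have h1 : exitHeight e Ω ℓ x ∈ closure (Ioo 0 (exitHeight e Ω ℓ x)) := by
    rw [closure_Ioo (by linarith)]
    exact ⟨by linarith, le_rfl⟩
  refine map_mem_closure (continuous_chartPoint_right e x) h1 fun t ht => ?_
  exact H.chartPoint_mem_of_lt_exitHeight (by linarith) ht.1.le ht.2

/-- If there is not too much boundary over a ball, one of many given horizontal discs over this
ball is contained in `Ω`. -/
theorem exists_level {D : ℝ≥0∞} {s α : ℝ} {N : ℕ} (hs : 0 < s)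
    (hdens : ∀ p ∈ frontier Ω, D ≤ μHE[n - 1] (frontier Ω ∩ ball p s))
    (hx : ‖x‖ + 4 * s ≤ w / 2)
    (hN : μHE[n - 1] (frontier Ω ∩ ball Q r ∩ {p | (e p).fst ∈ closedBall x (4 * s)}) < N * D)
    (hα : 0 ≤ α) (hαN : α + 3 * s * N ≤ exitHeight e Ω ℓ x) :
    ∃ T, α ≤ T ∧ T ≤ α + 3 * s * N ∧ ∀ z ∈ ball x (3 * s), chartPoint e z T ∈ Ω := by
  have hw := H.width_pos
  have hr := H.two_width_lt
  have hxw : ‖x‖ < w := by linarith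
  by_contra! hcon
  -- If all discs at heights `α + 3 * s * j` leave `Ω`, each meets the boundary, since its centre
  -- lies below the exit height and so in `Ω`. The spacing makes the `s`-balls about these points
  -- disjoint, and their boundary measures add up to `N * D`.
  have hcross : ∀ j ∈ Finset.range N, ∃ p ∈ frontier Ω, (e p).snd = α + 3 * s * j ∧
      (e p).fst ∈ ball x (3 * s) := by
    intro j hj
    have hjN : (j : ℝ) + 1 ≤ N := by exact_mod_cast Finset.mem_range.1 hj
    obtain ⟨z, hz, hzΩ⟩ := hcon (α + 3 * s * j) (by nlinarith [Nat.cast_nonneg (α := ℝ) j])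
      (by nlinarith)
    have hxΩ : chartPoint e x (α + 3 * s * j) ∈ Ω :=
      H.chartPoint_mem_of_lt_exitHeight hxw (by positivity) (by nlinarith)
    have hconn : IsPreconnected ((fun z => chartPoint e z (α + 3 * s * j)) '' ball x (3 * s)) :=
      (convex_ball x _).isPreconnected.image _ (continuous_chartPoint_left e _).continuousOn
    obtain ⟨_, ⟨z', hz', rfl⟩, hp⟩ := exists_mem_frontier_of_isPreconnected hconn
      ⟨x, mem_ball_self (by linarith), rfl⟩ ⟨z, hz, rfl⟩ hxΩ hzΩ
    exact ⟨_, hp, by simp, by simpa using hz'⟩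
  choose! p hp hpsnd hpfst using hcross
  have hdisj : (↑(Finset.range N) : Set ℕ).PairwiseDisjoint fun j => frontier Ω ∩ ball (p j) s := by
    intro i hi j hj hij
    refine Disjoint.mono inter_subset_right inter_subset_right (ball_disjoint_ball ?_)
    refine le_trans ?_ (dist_chart_snd_le e _ _)
    rw [hpsnd i hi, hpsnd j hj, Real.dist_eq]
    have h1 : (1 : ℝ) ≤ |(i : ℝ) - j| := by
      have : (1 : ℤ) ≤ |(i : ℤ) - j| := Int.one_le_abs (by omega)
      exact_mod_cast this
    have h2 : α + 3 * s * i - (α + 3 * s * j) = 3 * s * (i - j) := by ring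
    rw [h2, abs_mul, abs_of_pos (by linarith : 0 < 3 * s)]
    nlinarith
  refine hN.not_ge ?_
  calc (N : ℝ≥0∞) * D = ∑ j ∈ Finset.range N, D := by simp
    _ ≤ ∑ j ∈ Finset.range N, μHE[n - 1] (frontier Ω ∩ ball (p j) s) :=
        Finset.sum_le_sum fun j hj => hdens _ (hp j hj)
    _ = μHE[n - 1] (⋃ j ∈ Finset.range N, frontier Ω ∩ ball (p j) s) :=
        (measure_biUnion_finset hdisj fun j _ =>
          isClosed_frontier.measurableSet.inter measurableSet_ball).symm
    _ ≤ _ := by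
        refine measure_mono (iUnion₂_subset fun j hj q hq => ?_)
        have h1 := (dist_chart_fst_le e q (p j)).trans_lt hq.2
        have h2 : dist (e (p j)).fst x < 3 * s := hpfst j hj
        have h3 := dist_triangle (e q).fst (e (p j)).fst x
        have h4 : ‖(e (p j)).fst‖ ≤ dist (e (p j)).fst x + ‖x‖ := by
          simpa using dist_triangle (e (p j)).fst x 0
        have hjN : (j : ℝ) + 1 ≤ N := by exact_mod_cast Finset.mem_range.1 hj
        have h5 : dist (p j) Q < r / 2 + ‖(e (p j)).fst‖ := by
          have := H.dist_lt (e (p j)).fst (e (p j)).snd ?_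
          · rwa [chartPoint_chart] at this
          · rw [hpsnd j hj]
            exact ⟨by positivity, le_trans (by nlinarith) (hαN.trans (H.exitHeight_mem_Icc hxw).2)⟩
        have h6 := dist_triangle q (p j) Q
        have h7 : dist q (p j) < s := hq.2
        refine ⟨⟨hq.1, ?_⟩, ?_⟩
        · rw [mem_ball]
          linarith
        · change dist (e q).fst x ≤ 4 * s
          linarith

end IsCrossingColumn

/-- The points of `∂Ω` that have no point of `Ω` directly below them up to distance `b`, but a
point of `Ω` below them within distance `c`. -/
def upcrossing (e : CartesianChart n) (Ω : Set (EuclideanSpace ℝ (Fin n))) (b c : ℝ) :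
    Set (EuclideanSpace ℝ (Fin n)) :=
  {p | p ∈ frontier Ω ∧ (∀ u ∈ Ioo 0 b, chartPoint e (e p).fst ((e p).snd - u) ∉ Ω) ∧
    ∃ u ∈ Ioo 0 c, chartPoint e (e p).fst ((e p).snd - u) ∈ Ω}

/-- The gap of `Ω` below an upcrossing point records its scale, so boundary measure found at
separated scales may be summed. -/
theorem disjoint_upcrossing (e : CartesianChart n) (Ω : Set (EuclideanSpace ℝ (Fin n)))
    {b c b' c' : ℝ} (h : c' ≤ b) : Disjoint (upcrossing e Ω b c) (upcrossing e Ω b' c') := by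
  rw [Set.disjoint_left]
  rintro p ⟨-, hp, -⟩ ⟨-, -, u, hu, hu'⟩
  exact hp u ⟨hu.1, hu.2.trans_le h⟩ hu'

theorem measurableSet_upcrossing (e : CartesianChart n) {Ω : Set (EuclideanSpace ℝ (Fin n))}
    (hΩ : IsOpen Ω) (b c : ℝ) : MeasurableSet (upcrossing e Ω b c) := by
  have hopen : ∀ c, IsOpen {p | ∃ u ∈ Ioo 0 c, chartPoint e (e p).fst ((e p).snd - u) ∈ Ω} := by
    intro c
    have : {p | ∃ u ∈ Ioo 0 c, chartPoint e (e p).fst ((e p).snd - u) ∈ Ω} =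
        ⋃ u ∈ Ioo 0 c, {p | chartPoint e (e p).fst ((e p).snd - u) ∈ Ω} := by
      ext p
      simp
    rw [this]
    exact isOpen_biUnion fun u _ => hΩ.preimage ((continuous_chartPoint e).comp
      ((continuous_chart_fst e).prodMk ((continuous_chart_snd e).sub continuous_const)))
  have h : upcrossing e Ω b c = frontier Ω ∩
      ({p | ∃ u ∈ Ioo 0 b, chartPoint e (e p).fst ((e p).snd - u) ∈ Ω}ᶜ ∩
        {p | ∃ u ∈ Ioo 0 c, chartPoint e (e p).fst ((e p).snd - u) ∈ Ω}) := by
    ext p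
    simp [upcrossing]
    tauto
  rw [h]
  exact isClosed_frontier.measurableSet.inter
    ((hopen b).measurableSet.compl.inter (hopen c).measurableSet)

namespace IsCrossingColumn

variable {e : CartesianChart n} {Ω : Set (EuclideanSpace ℝ (Fin n))}
  {Q : EuclideanSpace ℝ (Fin n)} {r w ℓ : ℝ} (H : IsCrossingColumn e Ω Q r w ℓ)
  {x : EuclideanSpace ℝ (Fin (n - 1))}

include H

/-- Where the exit height drops steeply and there is not too much boundary, the boundary goes up
and down, so that it has many upcrossing points. -/
theorem volume_ball_le_measure_upcrossing {M R s : ℝ} (hM : 1 < M) (hn : 1 ≤ n)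
    (hΩ : IsCorkscrewDomain Ω M R) {N : ℕ} (hs : 0 < s) (hsR : s < R)
    (hx : ‖x‖ + 4 * s ≤ w / 2)
    (hN : μHE[n - 1] (frontier Ω ∩ ball Q r ∩ {p | (e p).fst ∈ closedBall x (4 * s)}) <
      N * volume (ball (0 : EuclideanSpace ℝ (Fin (n - 1))) (s / (2 * M))))
    {y : EuclideanSpace ℝ (Fin (n - 1))} (hxy : dist x y ≤ s)
    (hdrop : exitHeight e Ω ℓ y + (3 * N + 2) * s ≤ exitHeight e Ω ℓ x) :
    volume (ball (0 : EuclideanSpace ℝ (Fin (n - 1))) (s / (2 * M))) ≤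
      μHE[n - 1] (upcrossing e Ω (s / (2 * M)) ((6 * N + 6) * s) ∩
        (frontier Ω ∩ ball Q r ∩ {p | (e p).fst ∈ closedBall x (4 * s)})) := by
  have hw := H.width_pos
  have hr := H.two_width_lt
  have hN0 : (0 : ℝ) ≤ N := Nat.cast_nonneg N
  have hdens := fun p hp => hΩ.volume_ball_le_measure_frontier hn hM (p := p) hp hs hsR
  have hyx : ‖y‖ ≤ ‖x‖ + s := by
    have := dist_triangle_left y 0 x
    simp only [dist_zero_right] at this
    linarith
  have hyw : ‖y‖ < w / 2 := by linarith
  have hy0 := H.half_width_le_exitHeight hyw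
  have hxw : ‖x‖ < w := by linarith
  have hx1 := H.exitHeight_mem_Icc hxw
  set η := exitHeight e Ω ℓ y with hη
  -- The exterior ball about `A` is the obstacle that separates the two discs in `Ω` found next.
  obtain ⟨A, hA⟩ := hΩ.exterior_corkscrew _ (H.chartPoint_exitHeight_mem_frontier hyw) s hs hsR
  rw [← hη] at hA
  have hAfst : dist (e A).fst y < s := by
    simpa using (dist_chart_fst_le e A (chartPoint e y η)).trans_lt hA.2.1
  have hAsnd : |(e A).snd - η| < s := by
    simpa [Real.dist_eq] using (dist_chart_snd_le e A (chartPoint e y η)).trans_lt hA.2.1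
  rw [abs_lt] at hAsnd
  set τ := (e A).snd with hτ
  have hsM : s / (2 * M) + s / (2 * M) = s / M := by field_simp; norm_num
  have hsM0 : 0 < s / (2 * M) := by positivity
  have hsM1 : s / (2 * M) < s := by
    rw [div_lt_iff₀ (by linarith)]
    nlinarith
  have hext : ∀ z ∈ ball (e A).fst (s / (2 * M)), ∀ t, |t - τ| < s / (2 * M) →
      chartPoint e z t ∈ (closure Ω)ᶜ := by
    intro z hz t ht
    refine hA.ball_subset (a := chartPoint e z t) ?_
    rw [mem_ball]
    have h1 := dist_chartPoint_le e z (e A).fst t (e A).snd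
    rw [chartPoint_chart] at h1
    rw [mem_ball] at hz
    linarith
  obtain ⟨T₁, hT₁, hT₁', hT₁Ω⟩ := H.exists_level (α := η + 2 * s) hs hdens hx hN (by linarith)
    (by linarith)
  -- The lower disc comes from `exists_level` if there is room above height 0, and otherwise from
  -- the neighbourhood of the bottom of the column.
  obtain ⟨T₀, hT₀, hT₀', hT₀'', hT₀Ω⟩ : ∃ T₀, 0 ≤ T₀ ∧ T₀ < τ ∧ τ - (3 * N + 3) * s < T₀ ∧
      ∀ z ∈ ball x (3 * s), chartPoint e z T₀ ∈ Ω := by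
    rcases le_total 0 (η - 2 * s - 3 * s * N) with h0 | h0
    · obtain ⟨T, hT, hT', hTΩ⟩ := H.exists_level (α := η - 2 * s - 3 * s * N) hs hdens hx hN h0
        (by nlinarith)
      exact ⟨T, by linarith, by linarith, by linarith, hTΩ⟩
    · refine ⟨0, le_rfl, by linarith [norm_nonneg x], by linarith, fun z hz => ?_⟩
      refine H.bottom_mem z 0 ?_
      have := dist_triangle z x 0
      rw [mem_ball] at hz
      simp only [dist_zero_right] at this
      simp only [abs_zero]
      linarith
  rw [← Measure.addHaar_ball_center volume (e A).fst]
  refine le_trans (measure_mono fun z hz => ?_) (volume_image_chart_fst_le e _)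
  have hzx : dist z x < 3 * s := by
    have h1 := dist_triangle4 z (e A).fst y x
    rw [dist_comm y x] at h1
    rw [mem_ball] at hz
    linarith
  have hzn : ‖z‖ < ‖x‖ + 3 * s := by
    have := dist_triangle z x 0
    simp only [dist_zero_right] at this
    linarith
  -- `V` is the first height above the centre of the exterior ball at which the line meets `closure
  -- Ω`. Below it there is a gap of length at least `s / (2 * M)`, and then `Ω` again at `T₀`, less
  -- than `(6 * N + 6) * s` lower.
  obtain ⟨hV, hVcl, hVlt⟩ := exists_first_exit (e := e) (isClosed_closure (s := Ω)).isOpen_compl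
    (x := z) (t₀ := τ) (t₁ := T₁) (by linarith) fun h => h (subset_closure (hT₁Ω z hzx))
  set V := sInf {t | t ∈ Icc τ T₁ ∧ chartPoint e z t ∉ (closure Ω)ᶜ}
  have hVτ : τ + s / (2 * M) ≤ V := by
    by_contra! h
    refine hVcl (hext z hz V ?_)
    rw [abs_of_nonneg (by linarith [hV.1])]
    linarith
  have hbelow : ∀ t, τ - s / (2 * M) < t → t < V → chartPoint e z t ∉ Ω := by
    intro t ht1 ht2 hmem
    rcases le_total τ t with h | h
    · exact hVlt t h ht2 (subset_closure hmem)
    · refine hext z hz t ?_ (subset_closure hmem)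
      rw [abs_of_nonpos (by linarith)]
      linarith
  have hVΩ : chartPoint e z V ∉ Ω := by
    have h1 : V ∈ closure (Ioo (τ - s / (2 * M)) V) := by
      rw [closure_Ioo (by linarith)]
      exact ⟨by linarith, le_rfl⟩
    have h2 := map_mem_closure (t := Ωᶜ) (continuous_chartPoint_right e z) h1
      fun t ht => hbelow t ht.1 ht.2
    rwa [H.isOpen.isClosed_compl.closure_eq] at h2
  have hVf : chartPoint e z V ∈ frontier Ω := by
    rw [H.isOpen.frontier_eq]
    exact ⟨not_not.1 hVcl, hVΩ⟩
  have hVℓ : V ∈ Icc 0 ℓ := ⟨by linarith, by linarith [hV.2, hx1.2]⟩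
  refine ⟨chartPoint e z V, ⟨⟨hVf, ?_, V - T₀, ⟨by linarith, ?_⟩, ?_⟩, ⟨hVf, ?_⟩, ?_⟩, by simp⟩
  · intro u hu
    simp only [chart_chartPoint_fst, chart_chartPoint_snd]
    exact hbelow _ (by linarith [hu.2]) (by linarith [hu.1])
  · linarith [hV.2]
  · simpa using hT₀Ω z hzx
  · rw [mem_ball]
    linarith [H.dist_lt z V hVℓ]
  · change dist (e (chartPoint e z V)).fst x ≤ 4 * s
    rw [chart_chartPoint_fst]
    linarith

end IsCrossingColumn

end Column

/-! ### The exit height is Lipschitz outside a small set -/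

section Contact

variable {n : ℕ}

/-- The Vitali estimate is applied to the pushforward of the boundary measure under projection. The
factor `8 * M` is the ratio of the radii `4 * s` and `s / (2 * M)`. -/
theorem volume_le_of_forall_exists_column (e : CartesianChart n)
    {T : Set (EuclideanSpace ℝ (Fin n))} {S : Set (EuclideanSpace ℝ (Fin (n - 1)))} {A : ℝ≥0∞}
    {M s₀ : ℝ} (hM : 0 < M)
    (h : ∀ x ∈ S, ∃ s, 0 < s ∧ s ≤ s₀ ∧
      volume (ball (0 : EuclideanSpace ℝ (Fin (n - 1))) (s / (2 * M))) ≤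
        A * μHE[n - 1] (T ∩ {p | (e p).fst ∈ closedBall x (4 * s)})) :
    volume S ≤ 4 ^ (n - 1) * ENNReal.ofReal (8 * M) ^ (n - 1) * A * μHE[n - 1] T := by
  have hmeas : Measurable fun p : EuclideanSpace ℝ (Fin n) => (e p).fst :=
    (continuous_chart_fst e).measurable
  have key := volume_le_of_forall_exists_closedBall (S := S)
    (m := (μHE[n - 1].restrict T).map fun p => (e p).fst)
    (A := ENNReal.ofReal (8 * M) ^ (n - 1) * A) (R := 4 * s₀) fun x hx => ?_
  · rw [Measure.map_apply hmeas MeasurableSet.univ, preimage_univ, Measure.restrict_apply_univ] at key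
    rwa [mul_assoc (4 ^ (n - 1))]
  · obtain ⟨s, hs, hs₀, hsA⟩ := h x hx
    refine ⟨4 * s, by linarith, by linarith, ?_⟩
    rw [Measure.map_apply hmeas measurableSet_closedBall,
      Measure.restrict_apply (hmeas measurableSet_closedBall), mul_assoc, inter_comm]
    have h1 : 4 * s = 8 * M * (s / (2 * M)) := by field_simp; norm_num
    nth_rewrite 1 [h1]
    rw [Measure.addHaar_ball_mul_of_pos _ _ (by positivity), finrank_euclideanSpace_fin,
      ENNReal.ofReal_pow (by positivity)]
    gcongr
    exact hsA

/-- A positive number below `1` is comparable to many consecutive terms of a geometric sequence. -/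
theorem exists_pow_window {q τ : ℝ} (hq : 0 < q) (hq1 : q < 1) (hτ : 0 < τ) (hτ1 : τ < 1) (N : ℕ) :
    ∃ k₀ : ℕ, ∀ k ∈ Finset.Ico k₀ (k₀ + N), q ^ k ≤ τ ∧ q ^ N * τ ≤ q ^ k := by
  classical
  have hex : ∃ k, q ^ k ≤ τ := (exists_pow_lt_of_lt_one hτ hq1).imp fun _ => le_of_lt
  obtain ⟨k₀, h1, h2⟩ : ∃ k₀, q ^ (k₀ + 1) ≤ τ ∧ τ < q ^ k₀ := by
    obtain ⟨m, hm⟩ : ∃ m, Nat.find hex = m + 1 := Nat.exists_eq_succ_of_ne_zero fun h0 => by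
      have := Nat.find_spec hex
      rw [h0, pow_zero] at this
      linarith
    exact ⟨m, hm ▸ Nat.find_spec hex, not_le.1 (Nat.find_min hex (by omega))⟩
  refine ⟨k₀ + 1, fun k hk => ?_⟩
  rw [Finset.mem_Ico] at hk
  refine ⟨(pow_le_pow_of_le_one hq.le hq1.le hk.1).trans h1, ?_⟩
  calc q ^ N * τ ≤ q ^ N * q ^ k₀ := by gcongr
    _ = q ^ (N + k₀) := (pow_add _ _ _).symm
    _ ≤ q ^ k := pow_le_pow_of_le_one hq.le hq1.le (by omega)

/-- Markov's inequality for the multiplicity of a cover by sets that need not be measurable. -/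
theorem natCast_mul_measure_le_tsum {X : Type*} [MeasurableSpace X] (μ : Measure X) {B : Set X}
    {S : ℕ → Set X} {N : ℕ} (h : ∀ x ∈ B, ∃ k₀, ∀ k ∈ Finset.Ico k₀ (k₀ + N), x ∈ S k) :
    N * μ B ≤ ∑' k, μ (S k) := by
  have hmeas : ∀ k, Measurable ((toMeasurable μ (S k)).indicator fun _ => (1 : ℝ≥0∞)) :=
    fun k => measurable_const.indicator (measurableSet_toMeasurable _ _)
  calc (N : ℝ≥0∞) * μ B
      -- Measurable hulls of the `S k` have the same measures and make Markov's inequality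
      -- available.
      ≤ N * μ {x | (N : ℝ≥0∞) ≤ ∑' k, (toMeasurable μ (S k)).indicator (fun _ => 1) x} := by
        gcongr
        intro x hx
        obtain ⟨k₀, hk₀⟩ := h x hx
        calc (N : ℝ≥0∞) = ∑ k ∈ Finset.Ico k₀ (k₀ + N), 1 := by simp
          _ = ∑ k ∈ Finset.Ico k₀ (k₀ + N),
              (toMeasurable μ (S k)).indicator (fun _ => (1 : ℝ≥0∞)) x :=
            Finset.sum_congr rfl fun k hk =>
              (indicator_of_mem (subset_toMeasurable μ _ (hk₀ k hk)) fun _ => (1 : ℝ≥0∞)).symm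
          _ ≤ _ := ENNReal.sum_le_tsum _
    _ ≤ ∫⁻ x, ∑' k, (toMeasurable μ (S k)).indicator (fun _ => 1) x ∂μ :=
        mul_meas_ge_le_lintegral (Measurable.tsum hmeas) _
    _ = ∑' k, μ (S k) := by
        rw [lintegral_tsum fun k => (hmeas k).aemeasurable]
        congr with k
        rw [lintegral_indicator_const (measurableSet_toMeasurable _ _), one_mul,
          measure_toMeasurable]

variable {e : CartesianChart n} {Ω : Set (EuclideanSpace ℝ (Fin n))}
  {Q : EuclideanSpace ℝ (Fin n)} {r w ℓ : ℝ}

/-- If the area of `∂Ω` near `Q` is finite, then the exit height agrees with a Lipschitz function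
outside of a set of small measure. -/
theorem IsCrossingColumn.mul_volume_noncontact_le (H : IsCrossingColumn e Ω Q r w ℓ) {M R L : ℝ}
    (hM : 1 < M) (hn : 1 ≤ n) (hΩ : IsCorkscrewDomain Ω M R) (hrR : r < R) (hw : w = r / (2 * M))
    {N : ℕ} (hL : (32 * M + 3 * N + 2) * (2 * M * (6 * N + 6)) ^ N ≤ L) :
    N * volume {x | x ∈ ball (0 : EuclideanSpace ℝ (Fin (n - 1))) (w / 8) ∧
        ∃ y, ‖y‖ < w / 2 ∧ exitHeight e Ω ℓ y + L * dist x y < exitHeight e Ω ℓ x} ≤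
      2 * (4 ^ (n - 1) * ENNReal.ofReal (8 * M) ^ (n - 1)) *
        μHE[n - 1] (frontier Ω ∩ ball Q r) := by
  have hw0 := H.width_pos
  have hr : 0 < r := by linarith [H.two_width_lt]
  set W := frontier Ω ∩ ball Q r
  set K : ℝ≥0∞ := 4 ^ (n - 1) * ENNReal.ofReal (8 * M) ^ (n - 1)
  set h := exitHeight e Ω ℓ
  let v : ℝ → ℝ≥0∞ := fun s => volume (ball (0 : EuclideanSpace ℝ (Fin (n - 1))) (s / (2 * M)))
  let col : EuclideanSpace ℝ (Fin (n - 1)) → ℝ → Set (EuclideanSpace ℝ (Fin n)) :=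
    fun x s => {p | (e p).fst ∈ closedBall x (4 * s)}
  -- The term `32 * M` gives `s₀ ≤ w / 16`, and `3 * N + 2` makes `(3 * N + 2) * s₀ ≤ r`.
  let C₂ : ℝ := 32 * M + 3 * N + 2
  have hN0 : (0 : ℝ) ≤ N := Nat.cast_nonneg N
  have hC₂ : 0 < C₂ := by positivity
  -- With this ratio the upper window `(6 * N + 6) * s` of one scale is the lower gap `s / (2 * M)`
  -- of the preceding scale, so upcrossing sets of different scales are disjoint.
  let q : ℝ := (2 * M * (6 * N + 6))⁻¹
  have hq : 0 < q := by positivity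
  have hq1 : q < 1 := inv_lt_one_of_one_lt₀ (by nlinarith)
  let s₀ : ℝ := r / C₂
  have hs₀ : 0 < s₀ := by positivity
  have hs₀w : s₀ ≤ w / 16 := by
    rw [hw, div_le_iff₀ hC₂]
    have : r / (2 * M) / 16 * (32 * M) = r := by field_simp; norm_num
    have h2 : 0 ≤ r / (2 * M) / 16 * (3 * N + 2) := by positivity
    simp only [C₂]
    nlinarith
  have hs₀r : s₀ < r := by linarith [H.two_width_lt]
  let bad : Set (EuclideanSpace ℝ (Fin (n - 1))) :=
    {x | ∃ s, 0 < s ∧ s ≤ s₀ ∧ N * v s ≤ μHE[n - 1] (W ∩ col x s)}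
  have hbad : N * volume bad ≤ K * μHE[n - 1] W := by
    rcases Nat.eq_zero_or_pos N with hN | hN
    · simp [hN]
    have hN1 : (N : ℝ≥0∞) ≠ 0 := by exact_mod_cast hN.ne'
    have := volume_le_of_forall_exists_column (T := W) (S := bad) (A := (N : ℝ≥0∞)⁻¹) (s₀ := s₀) e
      (M := M) (by linarith) fun x hx => by
        obtain ⟨s, hs, hss, hx⟩ := hx
        refine ⟨s, hs, hss, ?_⟩
        rw [mul_comm (N : ℝ≥0∞)⁻¹, ← div_eq_mul_inv, ENNReal.le_div_iff_mul_le (Or.inl hN1)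
          (Or.inl (ENNReal.natCast_ne_top N)), mul_comm]
        exact hx
    calc N * volume bad ≤ N * (K * (N : ℝ≥0∞)⁻¹ * μHE[n - 1] W) := by gcongr
      _ = (N * (N : ℝ≥0∞)⁻¹) * (K * μHE[n - 1] W) := by ring
      _ = K * μHE[n - 1] W := by
        rw [ENNReal.mul_inv_cancel hN1 (ENNReal.natCast_ne_top N), one_mul]
  let S : ℕ → Set (EuclideanSpace ℝ (Fin (n - 1))) := fun k =>
    {x | x ∈ ball 0 (w / 8) ∧ x ∉ bad ∧ ∃ y, dist x y ≤ q ^ k * s₀ ∧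
      h y + (3 * N + 2) * (q ^ k * s₀) ≤ h x}
  let P : ℕ → Set (EuclideanSpace ℝ (Fin n)) := fun k =>
    upcrossing e Ω (q ^ k * s₀ / (2 * M)) ((6 * N + 6) * (q ^ k * s₀)) ∩ W
  have hsk : ∀ k, 0 < q ^ k * s₀ ∧ q ^ k * s₀ ≤ s₀ := fun k =>
    ⟨by positivity, mul_le_of_le_one_left hs₀.le (pow_le_one₀ hq.le hq1.le)⟩
  have hS : ∀ k, volume (S k) ≤ K * μHE[n - 1] (P k) := fun k => by
    have := volume_le_of_forall_exists_column (T := P k) (S := S k) (A := 1) (s₀ := s₀) e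
      (M := M) (by linarith) fun x hx => by
        obtain ⟨hx, hxb, y, hxy, hy⟩ := hx
        refine ⟨q ^ k * s₀, (hsk k).1, (hsk k).2, ?_⟩
        rw [one_mul, inter_assoc]
        refine H.volume_ball_le_measure_upcrossing hM hn hΩ (hsk k).1
          (by linarith [(hsk k).2]) ?_ ?_ hxy hy
        · rw [mem_ball_zero_iff] at hx
          linarith [(hsk k).2]
        · by_contra! hle
          exact hxb ⟨_, (hsk k).1, (hsk k).2, hle⟩
    rwa [mul_one] at this
  have hPdisj : Pairwise (Function.onFun Disjoint P) := by
    refine (pairwise_disjoint_on P).2 fun j k hjk => ?_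
    refine Disjoint.mono inter_subset_left inter_subset_left (disjoint_upcrossing _ _ ?_)
    have h1 : q ^ k ≤ q ^ (j + 1) := pow_le_pow_of_le_one hq.le hq1.le hjk
    calc (6 * N + 6) * (q ^ k * s₀) ≤ (6 * N + 6) * (q ^ (j + 1) * s₀) := by gcongr
      _ = q ^ j * s₀ / (2 * M) := by
        rw [pow_succ]
        simp only [q]
        field_simp
  have hPmeas : ∀ k, MeasurableSet (P k) := fun k => (measurableSet_upcrossing e H.isOpen _ _).inter
    (isClosed_frontier.measurableSet.inter measurableSet_ball)
  have hsum : ∑' k, volume (S k) ≤ K * μHE[n - 1] W :=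
    calc ∑' k, volume (S k) ≤ ∑' k, K * μHE[n - 1] (P k) := ENNReal.tsum_le_tsum hS
      _ = K * μHE[n - 1] (⋃ k, P k) := by
        rw [ENNReal.tsum_mul_left, measure_iUnion hPdisj hPmeas]
      _ ≤ K * μHE[n - 1] W := by
        gcongr
        exact iUnion_subset fun k => inter_subset_right
  have hL0 : 0 < L := lt_of_lt_of_le (by positivity) hL
  have hmult := natCast_mul_measure_le_tsum volume (S := S) (N := N)
    (B := {x | x ∈ ball (0 : EuclideanSpace ℝ (Fin (n - 1))) (w / 8) ∧
        ∃ y, ‖y‖ < w / 2 ∧ h y + L * dist x y < h x} \ bad) fun x hx => by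
    obtain ⟨⟨hx, y, hy, hxy⟩, hxb⟩ := hx
    have hρ : 0 < dist x y := by
      rw [dist_pos]
      rintro rfl
      simp at hxy
    have hx8 := mem_ball_zero_iff.1 hx
    have hyh := (H.exitHeight_mem_Icc (x := y) (by linarith)).1
    have hxh := (H.exitHeight_mem_Icc (x := x) (by linarith)).2
    have hlt : L * dist x y < r := by linarith [H.length_lt]
    -- The window compares `q ^ k` with the relative drop: its upper bound makes the drop at least
    -- `(3 * N + 2) * s`, and its lower bound, with `L ≥ C₂ * q⁻¹ ^ N`, gives `dist x y ≤ s`.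
    obtain ⟨k₀, hk₀⟩ := exists_pow_window hq hq1 (τ := L * dist x y / r) (by positivity)
      ((div_lt_one hr).2 hlt) N
    refine ⟨k₀, fun k hk => ⟨hx, hxb, y, ?_, ?_⟩⟩
    · have h1 := (hk₀ k hk).2
      have h2 : C₂ * (q ^ N)⁻¹ ≤ L := by
        simpa only [q, inv_pow, inv_inv, C₂] using hL
      rw [← div_eq_mul_inv, div_le_iff₀ (by positivity)] at h2
      calc dist x y = C₂ * dist x y / C₂ := by field_simp
        _ ≤ L * q ^ N * dist x y / C₂ := by gcongr
        _ = q ^ N * (L * dist x y / r) * (r / C₂) := by field_simp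
        _ ≤ q ^ k * s₀ := by gcongr
    · have h1 := (hk₀ k hk).1
      have h3 : (3 * N + 2) * (q ^ k * s₀) ≤ L * dist x y := by
        calc (3 * N + 2) * (q ^ k * s₀) ≤ C₂ * (L * dist x y / r * s₀) := by
              gcongr
              simp only [C₂]
              linarith
          _ = L * dist x y := by
              simp only [s₀]
              field_simp
      linarith
  calc _ ≤ N * (volume ({x | x ∈ ball (0 : EuclideanSpace ℝ (Fin (n - 1))) (w / 8) ∧
        ∃ y, ‖y‖ < w / 2 ∧ h y + L * dist x y < h x} \ bad) + volume bad) := by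
        gcongr
        refine (measure_mono ?_).trans (measure_union_le _ _)
        rw [sdiff_union_self]
        exact subset_union_left
    _ ≤ K * μHE[n - 1] W + K * μHE[n - 1] W := by
        rw [mul_add]
        exact add_le_add (hmult.trans hsum) hbad
    _ = 2 * K * μHE[n - 1] W := by ring

end Contact

/-! ### Lipschitz minorants -/

section InfConvolution

variable {X : Type*} [PseudoMetricSpace X] {D : Set X} {h : X → ℝ} {L : ℝ≥0} {m : ℝ}

/-- The greatest `L`-Lipschitz function that is at most `h` on `D`. -/
noncomputable def lipschitzMinorant (D : Set X) (h : X → ℝ) (L : ℝ≥0) (x : X) : ℝ :=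
  ⨅ y : D, (h y + L * dist x y)

theorem bddBelow_lipschitzMinorant (hm : ∀ y ∈ D, m ≤ h y) (x : X) :
    BddBelow (range fun y : D => h y + L * dist x y) :=
  ⟨m, by
    rintro _ ⟨y, rfl⟩
    exact le_add_of_le_of_nonneg (hm y y.2) (by positivity)⟩

theorem le_lipschitzMinorant (hD : D.Nonempty) (hm : ∀ y ∈ D, m ≤ h y) (x : X) :
    m ≤ lipschitzMinorant D h L x := by
  have := hD.to_subtype
  exact le_ciInf fun y => le_add_of_le_of_nonneg (hm y y.2) (by positivity)

theorem lipschitzMinorant_le (hm : ∀ y ∈ D, m ≤ h y) {x : X} (hx : x ∈ D) :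
    lipschitzMinorant D h L x ≤ h x := by
  simpa [lipschitzMinorant] using ciInf_le (bddBelow_lipschitzMinorant (L := L) hm x) ⟨x, hx⟩

theorem lipschitzWith_lipschitzMinorant (hD : D.Nonempty) (hm : ∀ y ∈ D, m ≤ h y) :
    LipschitzWith L (lipschitzMinorant D h L) := by
  have := hD.to_subtype
  refine LipschitzWith.of_le_add_mul L fun x y => ?_
  rw [← sub_le_iff_le_add]
  refine le_ciInf fun z => ?_
  have h1 := ciInf_le (bddBelow_lipschitzMinorant (L := L) hm x) z
  have h2 := mul_le_mul_of_nonneg_left (dist_triangle x y z) L.2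
  simp only [lipschitzMinorant, NNReal.val_eq_coe] at *
  linarith

end InfConvolution

/-! ### Construction of the column and of the domain -/

section Main

variable {n : ℕ}

theorem exists_isCrossingColumn (hn : 1 ≤ n) {Ω : Set (EuclideanSpace ℝ (Fin n))} {M R : ℝ}
    (hM : 1 < M) (hΩ : IsCorkscrewDomain Ω M R) {Q : EuclideanSpace ℝ (Fin n)}
    (hQ : Q ∈ frontier Ω) {r : ℝ} (hr : 0 < r) (hrR : r < R) {a : EuclideanSpace ℝ (Fin n)}
    (ha : IsNontangentialPoint Ω M Q (r / 2) a) :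
    ∃ (e : CartesianChart n) (ℓ : ℝ), chartPoint e 0 0 = a ∧
      IsCrossingColumn e Ω Q r (r / (2 * M)) ℓ := by
  obtain ⟨B, hB⟩ := hΩ.exterior_corkscrew Q hQ (r / 2) (by linarith) (by linarith)
  obtain ⟨e, hea, heB⟩ := exists_chart_through hn a B
  have hrM : r / 2 / M = r / (2 * M) := by field_simp
  have hrM' : 2 * (r / (2 * M)) = r / M := by field_simp
  refine ⟨e, dist a B, hea, hΩ.isOpen, by positivity, ?_, dist_nonneg, ?_, ?_, ?_, ?_⟩
  · rw [hrM']
    exact div_lt_self hr hM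
  · linarith [dist_triangle_right a B Q, ha.2.1, hB.2.1]
  · intro x t hxt
    refine ha.ball_subset ?_
    rw [mem_ball, hrM, ← hea]
    exact (dist_chartPoint_le e x 0 t 0).trans_lt (by simpa using hxt)
  · intro x hx hmem
    refine hB.ball_subset (a := chartPoint e x (dist a B)) ?_ (subset_closure hmem)
    rw [mem_ball, hrM]
    nth_rewrite 2 [← heB]
    exact (dist_chartPoint_le e _ _ _ _).trans_lt (by simpa using hx)
  · intro x t ht
    have h1 : dist (chartPoint e 0 t) Q < r / 2 :=
      dist_chartPoint_lt_of_mem_Icc e (hea ▸ ha.2.1) (heB.symm ▸ hB.2.1) ht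
    have h2 : dist (chartPoint e x t) (chartPoint e 0 t) ≤ ‖x‖ := by
      simpa using dist_chartPoint_le e x 0 t t
    linarith [dist_triangle (chartPoint e x t) (chartPoint e 0 t) Q]

theorem norm_le_mul_of_forall_abs_le {d : ℕ} {x : EuclideanSpace ℝ (Fin d)} {δ : ℝ} (hδ : 0 ≤ δ)
    (hx : ∀ i, |x i| ≤ δ) : ‖x‖ ≤ d * δ := by
  rw [EuclideanSpace.norm_eq, Real.sqrt_le_left (by positivity)]
  calc ∑ i, ‖x i‖ ^ 2 ≤ ∑ _i : Fin d, δ ^ 2 :=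
        Finset.sum_le_sum fun i _ => pow_le_pow_left₀ (norm_nonneg _) (hx i) 2
    _ = d * δ ^ 2 := by simp
    _ ≤ (d * δ) ^ 2 := by
        rcases Nat.eq_zero_or_pos d with rfl | hd
        · simp
        · have : (1 : ℝ) ≤ d := by exact_mod_cast hd
          rw [mul_pow]
          gcongr
          nlinarith

namespace IsCrossingColumn

variable {e : CartesianChart n} {Ω : Set (EuclideanSpace ℝ (Fin n))}
  {Q : EuclideanSpace ℝ (Fin n)} {r w ℓ : ℝ} (H : IsCrossingColumn e Ω Q r w ℓ)
  {φ : EuclideanSpace ℝ (Fin (n - 1)) → ℝ}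

include H

/-- Nonnegative heights are covered by the definition of first exit, negative ones by the
neighbourhood of the base point. The weak inequalities let this apply also to points of the closure
of the domain. -/
theorem mem_of_lt_exitHeight {p : EuclideanSpace ℝ (Fin n)} (hp1 : ‖(e p).fst‖ ≤ w / 4)
    (hp2 : -(w / 4) ≤ (e p).snd) (hp3 : (e p).snd < exitHeight e Ω ℓ (e p).fst) :
    p ∈ Ω ∩ ball Q r := by
  have hw := H.width_pos
  have hr := H.two_width_lt
  rw [← chartPoint_chart e p]
  rcases le_total 0 (e p).snd with h0 | h0
  · have h1 := (H.exitHeight_mem_Icc (x := (e p).fst) (by linarith)).2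
    refine ⟨H.chartPoint_mem_of_lt_exitHeight (by linarith) h0 hp3, ?_⟩
    rw [mem_ball]
    linarith [H.dist_lt (e p).fst (e p).snd ⟨h0, by linarith⟩]
  · have habs : |(e p).snd| = -(e p).snd := abs_of_nonpos h0
    refine ⟨H.bottom_mem _ _ (by linarith), ?_⟩
    have h1 := H.dist_lt 0 0 ⟨le_rfl, H.length_nonneg⟩
    have h2 := dist_chartPoint_le e (e p).fst 0 (e p).snd 0
    have h3 := dist_triangle (chartPoint e (e p).fst (e p).snd) (chartPoint e 0 0) Q
    simp only [norm_zero, dist_zero_right, sub_zero] at h1 h2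
    rw [mem_ball]
    linarith

theorem cubeBelowGraph_subset (hφ : ∀ x, ‖x‖ < w / 2 → φ x ≤ exitHeight e Ω ℓ x) {δ : ℝ}
    (hδ : 0 ≤ δ) (hδw : (n - 1 : ℕ) * δ ≤ w / 4) :
    cubeBelowGraph e φ δ (w / 4) ⊆ Ω ∩ ball Q r := fun p hp => by
  have hw := H.width_pos
  have h1 := (norm_le_mul_of_forall_abs_le hδ fun i => (hp.1 i).le).trans hδw
  exact H.mem_of_lt_exitHeight h1 hp.2.1.le (hp.2.2.trans_le (hφ _ (by linarith)))

theorem frontier_cubeBelowGraph_inter_subset (hφc : Continuous φ)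
    (hφ : ∀ x, ‖x‖ < w / 2 → φ x ≤ exitHeight e Ω ℓ x) {δ : ℝ}
    (hδ : 0 ≤ δ) (hδw : (n - 1 : ℕ) * δ ≤ w / 4) :
    frontier (cubeBelowGraph e φ δ (w / 4)) ∩ frontier Ω ⊆ graphSet e φ := by
  rintro p ⟨hp, hpΩ⟩
  have hw := H.width_pos
  obtain ⟨hp1, hp2, hp3⟩ := closure_cubeBelowGraph_subset hφc (frontier_subset_closure hp)
  have h1 := (norm_le_mul_of_forall_abs_le hδ hp1).trans hδw
  refine hp3.antisymm (not_lt.1 fun hlt => ?_)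
  rw [H.isOpen.frontier_eq] at hpΩ
  exact hpΩ.2 (H.mem_of_lt_exitHeight h1 hp2 (hlt.trans_le (hφ _ (by linarith)))).1

theorem chartPoint_mem_frontier_inter {δ : ℝ} {x : EuclideanSpace ℝ (Fin (n - 1))} (hx : ‖x‖ < δ)
    (hxw : ‖x‖ < w / 2) (hφx : φ x = exitHeight e Ω ℓ x) :
    chartPoint e x (φ x) ∈ frontier (cubeBelowGraph e φ δ (w / 4)) ∩ frontier Ω := by
  have hw := H.width_pos
  have h0 := H.half_width_le_exitHeight hxw
  refine ⟨⟨?_, fun h => ?_⟩, hφx ▸ H.chartPoint_exitHeight_mem_frontier hxw⟩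
  · have h1 : φ x ∈ closure (Ioo 0 (φ x)) := by
      rw [closure_Ioo (by linarith)]
      exact ⟨by linarith, le_rfl⟩
    refine map_mem_closure (continuous_chartPoint_right e x) h1 fun t ht => ?_
    simp only [cubeBelowGraph, mem_ofPred_eq, chart_chartPoint_fst, chart_chartPoint_snd]
    exact ⟨fun i => (PiLp.norm_apply_le x i).trans_lt hx, by linarith [ht.1], ht.2⟩
  · simpa using (interior_subset h).2.2

end IsCrossingColumn

theorem theorem2p4 (n : ℕ) (hn : 2 ≤ n) (M : ℝ) (hM : 1 < M) :
    ∃ ψ : ℝ, 0 < ψ ∧ ∀ γ : ℝ, ∃ (L : ℝ≥0) (N : ℕ) (c : ℝ), 0 < c ∧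
      ∀ (Ω : Set (EuclideanSpace ℝ (Fin n))) (R : ℝ), 0 < R → IsCorkscrewDomain Ω M R →
      ∀ Q ∈ frontier Ω, ∀ r : ℝ, 0 < r → r < R →
      μHE[n - 1] (frontier Ω ∩ ball Q r) ≤ ENNReal.ofReal (γ * r ^ (n - 1)) →
      ∀ a, IsNontangentialPoint Ω M Q (r / 2) a →
      ∃ ΩL : Set (EuclideanSpace ℝ (Fin n)),
        IsLipschitzDomain ΩL L N (c * r) ∧
        a ∈ ΩL ∧ ΩL ⊆ Ω ∩ ball Q r ∧
        ENNReal.ofReal (ψ * r ^ (n - 1)) ≤ μHE[n - 1] (frontier ΩL ∩ frontier Ω) ∧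
        ∃ (e : CartesianChart n) (φ : EuclideanSpace ℝ (Fin (n - 1)) → ℝ),
          LipschitzWith L φ ∧ frontier ΩL ∩ frontier Ω ⊆ graphSet e φ := by
  have hn1 : 1 ≤ n := by omega
  have hn2 : (2 : ℝ) ≤ n := by exact_mod_cast hn
  set V : ℝ≥0∞ := volume (ball (0 : EuclideanSpace ℝ (Fin (n - 1))) 1) with hV
  have hVtop : V ≠ ⊤ := measure_ball_lt_top.ne
  have hVpos : 0 < V.toReal := ENNReal.toReal_pos (measure_ball_pos _ _ one_pos).ne' hVtop
  -- `ψ * r ^ (n - 1)` is half the volume of the ball of radius `δ = r / (8 * M * n)`.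
  let ψ : ℝ := (1 / (8 * M * n)) ^ (n - 1) * V.toReal / 2
  have hψ : 0 < ψ := by positivity
  refine ⟨ψ, hψ, fun γ => ?_⟩
  let K : ℝ≥0∞ := 2 * (4 ^ (n - 1) * ENNReal.ofReal (8 * M) ^ (n - 1))
  have hK : K * ENNReal.ofReal γ ≠ ⊤ := by
    simp only [K]
    finiteness
  -- The number `k` of scales is chosen so that `K * γ < k * ψ`, which bounds the noncontact set by
  -- `ψ * r ^ (n - 1)`.
  obtain ⟨k, hk⟩ := ENNReal.exists_nat_mul_gt (ENNReal.ofReal_pos.2 hψ).ne' hK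
  have hk0 : (k : ℝ≥0∞) ≠ 0 := by
    rintro h0
    simp [h0] at hk
  let L : ℝ≥0 := ((32 * M + 3 * k + 2) * (2 * M * (6 * k + 6)) ^ k).toNNReal
  have hL : (32 * M + 3 * k + 2) * (2 * M * (6 * k + 6)) ^ k = (L : ℝ) :=
    (Real.coe_toNNReal _ (by positivity)).symm
  -- Then `2 * (c * r) = δ / (L + 1)` and `4 * (L + 1) * (c * r) = w / (2 * n)`, as the local charts
  -- require for roof height at least `w / 2` and floor depth `w / 4`.
  let c : ℝ := 1 / (16 * M * n * (L + 1))
  have hc : 0 < c := by positivity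
  obtain ⟨N, hN⟩ := exists_covering_number n hc
  refine ⟨n + (n * L + L + 1), N, c, hc, fun Ω R _ hΩ Q hQ r hr hrR hμ a ha => ?_⟩
  obtain ⟨e, ℓ, hea, H⟩ := exists_isCrossingColumn hn1 hM hΩ hQ hr hrR ha
  obtain ⟨w, hw⟩ : ∃ w, w = r / (2 * M) := ⟨_, rfl⟩
  rw [← hw] at H
  have hw0 := H.width_pos
  let δ : ℝ := w / (4 * n)
  have hδ : 0 < δ := by positivity
  have hδw : (n - 1 : ℕ) * δ ≤ w / 4 := by
    have h1 : ((n - 1 : ℕ) : ℝ) ≤ n := by exact_mod_cast Nat.sub_le n 1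
    calc ((n - 1 : ℕ) : ℝ) * δ ≤ n * δ := by gcongr
      _ = w / 4 := by simp only [δ]; field_simp
  have hδ8 : δ ≤ w / 8 := by
    simp only [δ]
    gcongr
    linarith
  let D : Set (EuclideanSpace ℝ (Fin (n - 1))) := ball 0 (w / 2)
  have hD : D.Nonempty := ⟨0, mem_ball_self (by linarith)⟩
  have hDh : ∀ y ∈ D, w / 2 ≤ exitHeight e Ω ℓ y := fun y hy =>
    H.half_width_le_exitHeight (mem_ball_zero_iff.1 hy)
  let φ := lipschitzMinorant D (exitHeight e Ω ℓ) L
  have hφL : LipschitzWith L φ := lipschitzWith_lipschitzMinorant hD hDh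
  have hφw : ∀ x, w / 2 ≤ φ x := le_lipschitzMinorant hD hDh
  have hφh : ∀ x, ‖x‖ < w / 2 → φ x ≤ exitHeight e Ω ℓ x := fun x hx =>
    lipschitzMinorant_le hDh (mem_ball_zero_iff.2 hx)
  have hsub := H.cubeBelowGraph_subset hφh hδ.le hδw
  have hcr : c * r = w / (8 * n * (L + 1)) := by
    simp only [c, hw]
    field_simp
    norm_num
  have hcr4 : 4 * ((L + 1) * (c * r)) = w / (2 * n) := by
    rw [hcr]
    field_simp
    norm_num
  refine ⟨cubeBelowGraph e φ δ (w / 4), ?_, ?_, hsub, ?_, e, φ, hφL.weaken ?_,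
    H.frontier_cubeBelowGraph_inter_subset hφL.continuous hφh hδ.le hδw⟩
  · refine isLipschitzDomain_cubeBelowGraph hn1 hφL ?_ ?_ (by positivity) hφw (by linarith)
      (by linarith) (hN Q r hr) (hsub.trans inter_subset_right)
    · have h1 : 2 * (c * r) = δ / (L + 1) := by
        rw [hcr]
        simp only [δ]
        field_simp
        norm_num
      rw [h1]
      exact div_le_self hδ.le (by linarith [L.2])
    · rw [hcr4]
      have : w / (2 * n) ≤ w / 2 := by
        gcongr
        linarith
      linarith
  · rw [← hea]
    simp only [cubeBelowGraph, mem_ofPred_eq, chart_chartPoint_fst, chart_chartPoint_snd]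
    exact ⟨fun i => by simpa using hδ, by linarith, by linarith [hφw 0]⟩
  · let nc : Set (EuclideanSpace ℝ (Fin (n - 1))) := {x | x ∈ ball 0 (w / 8) ∧
        ∃ y, ‖y‖ < w / 2 ∧ exitHeight e Ω ℓ y + L * dist x y < exitHeight e Ω ℓ x}
    have hX : ENNReal.ofReal (ψ * r ^ (n - 1)) = ENNReal.ofReal ψ * ENNReal.ofReal (r ^ (n - 1)) :=
      ENNReal.ofReal_mul hψ.le
    have hnc : volume nc ≤ ENNReal.ofReal (ψ * r ^ (n - 1)) := by
      rw [← ENNReal.mul_le_mul_iff_right hk0 (ENNReal.natCast_ne_top k)]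
      calc k * volume nc ≤ K * μHE[n - 1] (frontier Ω ∩ ball Q r) :=
            H.mul_volume_noncontact_le hM hn1 hΩ hrR hw hL.le
        _ ≤ K * ENNReal.ofReal (γ * r ^ (n - 1)) := by gcongr
        _ = K * ENNReal.ofReal γ * ENNReal.ofReal (r ^ (n - 1)) := by
            rw [ENNReal.ofReal_mul' (by positivity), ← mul_assoc]
        _ ≤ k * ENNReal.ofReal ψ * ENNReal.ofReal (r ^ (n - 1)) := by gcongr
        _ = k * ENNReal.ofReal (ψ * r ^ (n - 1)) := by rw [hX, mul_assoc]
    have hball : volume (ball (0 : EuclideanSpace ℝ (Fin (n - 1))) δ) =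
        ENNReal.ofReal (ψ * r ^ (n - 1)) + ENNReal.ofReal (ψ * r ^ (n - 1)) := by
      rw [Measure.addHaar_ball_of_pos _ _ hδ, finrank_euclideanSpace_fin, ← hV,
        ← ENNReal.ofReal_toReal hVtop, ← ENNReal.ofReal_mul (by positivity),
        ← ENNReal.ofReal_add (by positivity) (by positivity)]
      congr 1
      have h1 : δ = 1 / (8 * M * n) * r := by
        simp only [δ, hw]
        field_simp
        norm_num
      rw [h1, mul_pow]
      simp only [ψ]
      ring
    have hcontact : ball (0 : EuclideanSpace ℝ (Fin (n - 1))) δ \ nc ⊆ (fun p => (e p).fst) ''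
        (frontier (cubeBelowGraph e φ δ (w / 4)) ∩ frontier Ω) := by
      rintro x ⟨hx, hxn⟩
      rw [mem_ball_zero_iff] at hx
      have hxw : ‖x‖ < w / 2 := by linarith
      have := hD.to_subtype
      -- Off `nc` no competitor `y` in the infimum defining `φ x` falls below the exit height at
      -- `x`.
      have hφx : φ x = exitHeight e Ω ℓ x := (hφh x hxw).antisymm <| le_ciInf fun y =>
        not_lt.1 fun hlt => hxn ⟨by rw [mem_ball_zero_iff]; linarith, y, mem_ball_zero_iff.1 y.2, hlt⟩
      exact ⟨_, H.chartPoint_mem_frontier_inter hx hxw hφx, by simp⟩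
    refine le_trans ?_ (volume_image_chart_fst_le e _)
    have h2 : volume (ball (0 : EuclideanSpace ℝ (Fin (n - 1))) δ) ≤
        volume ((fun p => (e p).fst) ''
          (frontier (cubeBelowGraph e φ δ (w / 4)) ∩ frontier Ω)) +
          ENNReal.ofReal (ψ * r ^ (n - 1)) := by
      refine le_trans (measure_mono (t := (ball 0 δ \ nc) ∪ nc) ?_) ((measure_union_le _ _).trans
        (add_le_add (measure_mono hcontact) hnc))
      rw [sdiff_union_self]
      exact subset_union_left
    rw [hball] at h2
    exact (ENNReal.add_le_add_iff_right ENNReal.ofReal_ne_top).1 h2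
  · have h1 : (1 : ℝ≥0) ≤ n := by exact_mod_cast hn1
    calc L ≤ n * L := le_mul_of_one_le_left zero_le h1
      _ ≤ n + (n * L + L + 1) := by
        rw [add_assoc, add_left_comm]
        exact le_self_add

end Main
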